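/- **Setting.** Let $\Omega=(x_i,x_f)\subseteq\mathbb R$ be a bounded or unbounded open interval and let $f,h$ be probability densities on $\Omega$, both positive and differentiable on $\Omega$. All densities are regarded as functions on their open support interval, changes of variable are determined by their derivative up to an additive constant (i.e. they are primitives), and integrals of non-negative functions take values in $[0,\infty]$. **Transformations.** Let $\alpha>0$, $\gamma\in\mathbb R\setminus\{2\}$, $\delta>0$. * $\mathfrak R_\alpha^{[h]}[f](y)=\big(f(x(y))/h(x(y))\big)^\alpha$, where $y'(x)=f(x)^{1-\alpha}h(x)^\alpha$. * For a density $g$ on an interval with $r:=\big(\int g^{(\alpha-1)/\alpha}\big)^{\alpha}<\infty$, $\mathfrak R_\alpha^{-1,[h]}[g](x)=[r\,g(r\,y(x))]^{1/\alpha}h(x)$, where $y'(x)=[r\,g(r\,y(x))]^{-(\alpha-1)/\alpha}h(x)$ and $x\mapsto r\,y(x)$ maps $\Omega$ onto the support interval of $g$. * For a differentiable density $g$ with $g'<0$, $\mathfrak D_\gamma[g](s)=g(x(s))^\gamma/|g'(x(s))|$, where $s'(x)=g(x)^{1-\gamma}|g'(x)|$. * For a density $g$ on an interval not containing $0$, $\mathfrak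 U_\gamma[g](u)=|(\gamma-2)x(u)|^{1/(2-\gamma)}$, where $u'(x)=-|(\gamma-2)x|^{1/(\gamma-2)}g(x)$. * For a density $F$ on $\Omega$ with $K:=\int_\Omega h^\delta F^{1-\delta}<\infty$, $\mathfrak A_\delta^{(h)}[F](y)=K\big(F(x(y))/h(x(y))\big)^\delta h(y)$, where $x(y)$ is the inverse of the bijection $y:\Omega\to\Omega$ given by $\int_{x_i}^{y(x)}h=K^{-1}\int_{x_i}^xF^{1-\delta}h^\delta$. Put $\mathfrak D^{\mathfrak R,[h]}_{\gamma,\alpha}=\mathfrak R_\alpha^{-1,[h]}\circ\mathfrak D_\gamma\circ\mathfrak R_\alpha^{[h]}$, $\ \mathfrak U^{\mathfrak R,[h]}_{\gamma,\alpha}=\mathfrak R_\alpha^{-1,[h]}\circ\mathfrak U_\gamma\circ\mathfrak R_\alpha^{[h]}$ and $\mathfrak T_\delta=\mathfrak U^{\mathfrak R,[h]}_{\gamma,\alpha}\circ\mathfrak A_\delta^{(h)}\circ\mathfrak D^{\mathfrak R,[h]}_{\gamma,\alpha}$. A *version of $\mathfrak T_\delta[f]$* is any result of this composition, for any choice of the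 additive constants for which every step is defined. **Functionals.** For $p,\theta\in\mathbb R\setminus\{0\}$ let $$F_{p,\theta}[f\|h]=\int_\Omega f^{1+p(\theta-1)}h^{-\theta p}\Big|\frac{d}{dx}\log\frac fh\Big|^p dx\in[0,\infty],\quad \phi_{p,\theta}=F_{p,\theta}^{1/(p\theta)},\quad C_{\lambda,\beta,\theta}[f\|h]=\frac{\phi_{\lambda,\theta}[f\|h]}{\phi_{\beta,\theta}[f\|h]}\in[0,\infty]$$ (the derivative being needed only almost everywhere). We call $C_{\lambda,\beta,\theta}$ *defined* if the quotient is neither $0/0$ nor $\infty/\infty$. **Theorem 4.2.** Let $\lambda>\beta$ be nonzero reals, $\alpha\in(0,\infty)$, $\gamma\in\mathbb R\setminus\{2\}$ and $\theta=\alpha(2-\gamma)$. Assume that $f/h$ is decreasing, in the sense that $(f/h)'<0$ on $\Omega$, and that the integral defining $\phi_{1/\alpha,\theta}[f\|h]$ converges, i.e. $F_{1/\alpha,\theta}[f\|h]<\infty$. 1. Let $\delta\in(0,1)$. Then $\mathfrak T_\delta[f]$ is well defined (a version exists), and for every version, if $C_{\lambda,\beta,\theta}[f\|h]$ is defined then so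 is $C_{\lambda,\beta,\theta}[\mathfrak T_\delta[f]\|h]$, and $$C_{\lambda,\beta,\theta}\big[\mathfrak T_\delta[f]\,\big\|\,h\big]^{2-\gamma}\le C_{\lambda,\beta,\theta}[f\|h]^{2-\gamma}.$$ 2. Let $\delta>1$. Then for every version of $\mathfrak T_\delta[f]$ (whenever one exists), if $C_{\lambda,\beta,\theta}[\mathfrak T_\delta[f]\|h]$ is defined then so is $C_{\lambda,\beta,\theta}[f\|h]$, and $$C_{\lambda,\beta,\theta}\big[\mathfrak T_\delta[f]\,\big\|\,h\big]^{2-\gamma}\ge C_{\lambda,\beta,\theta}[f\|h]^{2-\gamma}.$$ -/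

import Mathlib

open MeasureTheory Set
open scoped ENNReal

noncomputable section

/-- The standing framework: `f` and `h` are positive probability densities on the same open
interval `Ω` (bounded or not).  Only the values on `Ω` matter. -/
structure DensityPair (Ω : Set ℝ) (f h : ℝ → ℝ) : Prop where
  isOpen : IsOpen Ω
  ordConnected : Ω.OrdConnected
  f_pos : ∀ x ∈ Ω, 0 < f x
  h_pos : ∀ x ∈ Ω, 0 < h x
  f_integral : ∫ x in Ω, f x = 1
  h_integral : ∫ x in Ω, h x = 1

/-- `y` is a primitive of `w` on the interval `Ω`: the meaning of "`y'(x) = w(x)`" for a change of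
variable that is determined up to an additive constant. -/
def IsPrimitiveOn (w y : ℝ → ℝ) (Ω : Set ℝ) : Prop :=
  ∀ a ∈ Ω, ∀ b ∈ Ω, IntervalIntegrable w volume a b ∧ ∫ t in a..b, w t = y b - y a

/-- Rényi entropy power `N_ξ[g] = (∫_Ω g^ξ)^{1/(1-ξ)}`, with values in `[0,∞]`. -/
def renyiPower (ξ : ℝ) (Ω : Set ℝ) (g : ℝ → ℝ) : ℝ≥0∞ :=
  (∫⁻ s in Ω, ENNReal.ofReal (g s) ^ ξ) ^ (1 / (1 - ξ))

/-- Relative differential-escort transformation: `(Ω', g)` is `R_α^{[h]}` of `(Ω, f)`, i.e.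
`g(y) = (f(x(y)) / h(x(y)))^α`, `y'(x) = f(x)^{1-α} h(x)^α`. -/
def IsRelEscort (α : ℝ) (h : ℝ → ℝ) (Ω : Set ℝ) (f : ℝ → ℝ) (Ω' : Set ℝ) (g : ℝ → ℝ) : Prop :=
  ∃ y : ℝ → ℝ,
    IsPrimitiveOn (fun x => f x ^ (1 - α) * h x ^ α) y Ω ∧
    y '' Ω = Ω' ∧
    ∀ x ∈ Ω, g (y x) = (f x / h x) ^ α

/-- Inverse relative differential-escort transformation: `F` (on the support `Ω` of `h`) is
`R_α^{-1,[h]}` of `(Ω', g)`.  It needs `r = N_{(α-1)/α}[g] < ∞`, and then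
`F(x) = [r g(r y(x))]^{1/α} h(x)`, `y'(x) = [r g(r y(x))]^{-(α-1)/α} h(x)`, where `x ↦ r y(x)` maps
`Ω` onto `Ω'`.  For `α = 1` the number `r` is the length of `Ω'`. -/
def IsRelEscortInv (α : ℝ) (h : ℝ → ℝ) (Ω' : Set ℝ) (g : ℝ → ℝ) (Ω : Set ℝ) (F : ℝ → ℝ) : Prop :=
  renyiPower ((α - 1) / α) Ω' g < ∞ ∧
  ∃ r : ℝ, r = (renyiPower ((α - 1) / α) Ω' g).toReal ∧
  ∃ y : ℝ → ℝ,
    IsPrimitiveOn (fun x => (r * g (r * y x)) ^ (-((α - 1) / α)) * h x) y Ω ∧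
    (fun x => r * y x) '' Ω = Ω' ∧
    ∀ x ∈ Ω, F x = (r * g (r * y x)) ^ (1 / α) * h x

/-- Down transformation of a differentiable density with negative derivative: `(Ω', G)` is
`D_γ` of `(Ω, g)`, i.e. `G(s) = g(x(s))^γ / |g'(x(s))|`, `s'(x) = g(x)^{1-γ} |g'(x)|`. -/
def IsDown (γ : ℝ) (Ω : Set ℝ) (g : ℝ → ℝ) (Ω' : Set ℝ) (G : ℝ → ℝ) : Prop :=
  (∀ x ∈ Ω, DifferentiableAt ℝ g x ∧ deriv g x < 0) ∧
  ∃ s : ℝ → ℝ,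
    IsPrimitiveOn (fun x => g x ^ (1 - γ) * |deriv g x|) s Ω ∧
    s '' Ω = Ω' ∧
    ∀ x ∈ Ω, G (s x) = g x ^ γ * |deriv g x|⁻¹

/-- Up transformation for `γ ≠ 2`: `(Ω', G)` is `U_γ` of `(Ω, g)`, i.e.
`G(u) = |(γ-2) x(u)|^{1/(2-γ)}`, `u'(x) = -|(γ-2) x|^{1/(γ-2)} g(x)`.  The support must not contain
the origin: this is what makes `G` a finite, positive, monotone density. -/
def IsUp (γ : ℝ) (Ω : Set ℝ) (g : ℝ → ℝ) (Ω' : Set ℝ) (G : ℝ → ℝ) : Prop :=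
  (0 : ℝ) ∉ Ω ∧
  ∃ u : ℝ → ℝ,
    IsPrimitiveOn (fun x => -(|(γ - 2) * x| ^ (1 / (γ - 2)) * g x)) u Ω ∧
    u '' Ω = Ω' ∧
    ∀ x ∈ Ω, G (u x) = |(γ - 2) * x| ^ (1 / (2 - γ))

/-- Divergence transformation: `F'` is `A_δ^{(h)}[F]` on `Ω`.  It needs
`K = K_δ[h‖F] = ∫_Ω h^δ F^{1-δ} < ∞`; the bijection `y : Ω → Ω` is given by
`H(y(x)) = K⁻¹ ∫_{x_i}^x F^{1-δ} h^δ` with `H(y) = ∫_{x_i}^y h`, and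
`F'(y) = K (F(x(y)) / h(x(y)))^δ h(y)`. -/
def IsDivergenceTransform (δ : ℝ) (h : ℝ → ℝ) (Ω : Set ℝ) (F F' : ℝ → ℝ) : Prop :=
  IntegrableOn (fun t => h t ^ δ * F t ^ (1 - δ)) Ω ∧
  ∃ K : ℝ, K = ∫ t in Ω, h t ^ δ * F t ^ (1 - δ) ∧
  ∃ y : ℝ → ℝ,
    BijOn y Ω Ω ∧
    (∀ x ∈ Ω, ∫ t in Ω ∩ Iio (y x), h t = K⁻¹ * ∫ t in Ω ∩ Iio x, h t ^ δ * F t ^ (1 - δ)) ∧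
    ∀ x ∈ Ω, F' (y x) = K * (F x / h x) ^ δ * h (y x)

/-- `F = (R_α^{-1,[h]} ∘ D_γ ∘ R_α^{[h]})[f]`. -/
def IsConjDown (γ α : ℝ) (h : ℝ → ℝ) (Ω : Set ℝ) (f F : ℝ → ℝ) : Prop :=
  ∃ (Ω₁ Ω₂ : Set ℝ) (g₁ g₂ : ℝ → ℝ),
    IsRelEscort α h Ω f Ω₁ g₁ ∧ IsDown γ Ω₁ g₁ Ω₂ g₂ ∧ IsRelEscortInv α h Ω₂ g₂ Ω F

/-- `F = (R_α^{-1,[h]} ∘ U_γ ∘ R_α^{[h]})[f]`. -/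
def IsConjUp (γ α : ℝ) (h : ℝ → ℝ) (Ω : Set ℝ) (f F : ℝ → ℝ) : Prop :=
  ∃ (Ω₁ Ω₂ : Set ℝ) (g₁ g₂ : ℝ → ℝ),
    IsRelEscort α h Ω f Ω₁ g₁ ∧ IsUp γ Ω₁ g₁ Ω₂ g₂ ∧ IsRelEscortInv α h Ω₂ g₂ Ω F

/-- `k` is the image of `f` under the conjugated transformation: conjugated down transformation,
then `A_δ^{(h)}`, then conjugated up transformation. -/
def IsConjugatedTransform (γ α δ : ℝ) (h : ℝ → ℝ) (Ω : Set ℝ) (f k : ℝ → ℝ) : Prop :=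
  ∃ F F' : ℝ → ℝ,
    IsConjDown γ α h Ω f F ∧ IsDivergenceTransform δ h Ω F F' ∧ IsConjUp γ α h Ω F' k

/-- `F_{p,θ}[f‖h] = ∫_Ω f^{1+p(θ-1)} h^{-θp} |(log (f/h))'|^p`, with values in `[0,∞]`. -/
def relFisherIntegral (p θ : ℝ) (Ω : Set ℝ) (f h : ℝ → ℝ) : ℝ≥0∞ :=
  ∫⁻ x in Ω, ENNReal.ofReal (f x ^ (1 + p * (θ - 1)) * h x ^ (-(θ * p))) *
    ENNReal.ofReal |deriv (fun t => Real.log (f t / h t)) x| ^ p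

/-- Relative Fisher divergence `φ_{p,θ}[f‖h] = F_{p,θ}[f‖h]^{1/(pθ)}`. -/
def relFisher (p θ : ℝ) (Ω : Set ℝ) (f h : ℝ → ℝ) : ℝ≥0∞ :=
  relFisherIntegral p θ Ω f h ^ (1 / (p * θ))

/-- Relative Fisher complexity `φ_{lam,θ}[f‖h] / φ_{β,θ}[f‖h]`. -/
def fisherComplexity (lam β θ : ℝ) (Ω : Set ℝ) (f h : ℝ → ℝ) : ℝ≥0∞ :=
  relFisher lam θ Ω f h / relFisher β θ Ω f h

/-- The quotient defining the complexity is meaningful: it is neither `0/0` nor `∞/∞`. -/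
def FisherComplexityDefined (lam β θ : ℝ) (Ω : Set ℝ) (f h : ℝ → ℝ) : Prop :=
  ¬ (relFisher lam θ Ω f h = 0 ∧ relFisher β θ Ω f h = 0) ∧
  ¬ (relFisher lam θ Ω f h = ∞ ∧ relFisher β θ Ω f h = ∞)

end

/-! Write `I p` for the relative Fisher integral of `f` with order `p` and θ = α(2-γ). It is the
`p`-th moment, under the probability measure `f dx`, of the single function X = f^(θ-1) h^(-θ) |(log
(f/h))'|. Hölder therefore makes log `I` convex (`DensityPair.relFisherIntegral_convex_comb`), and
`I 0` = 1.

The conjugated transformation acts on `I` by a dilation of the order. The escort and down steps turn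
`I p` into a power moment of exponent `1 - p`, the inverse escort turns that into a moment of F/h,
the divergence transformation replaces `t` by `δ * t` in such moments, and the last three steps undo
the first three. Each step contributes only a factor of the form (constant)^p, so the Fisher
integral of the image is `c ^ p * I (δ * p)` for some `c > 0`
(`IsConjugatedTransform.relFisherIntegral_eq`). The factor cancels in the complexity, and raising to
the power 2-γ leaves the positive exponent 1/α on the quotient I(δλ)^(1/λ) / I(δβ)^(1/β).

For δ < 1, the secant slope of log `I` between `δ * p` and `p` increases with `p`; this is exactly
the inequality between the two quotients (`toReal_log_slope_le`, and `QuotientDefined.of_logConvex`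
with infinite values admitted). For δ > 1, the same statement is applied to p ↦ I(δp) with ratio
1/δ.

Existence for δ < 1 (`exists_isConjugatedTransform`) amounts to integrability. The first inverse
escort uses the finiteness of `I (1 / α)`, the divergence transformation uses AM-GM, and the second
inverse escort is saved by the choice of additive constant before the up step, made differently for
γ < 2 and γ > 2. -/

/-! ### Primitives and monotone changes of variable with locally integrable weight -/

theorem IsPrimitiveOn.of_le {w y : ℝ → ℝ} {Ω : Set ℝ}
    (H : ∀ a ∈ Ω, ∀ b ∈ Ω, a ≤ b →
      IntervalIntegrable w volume a b ∧ ∫ t in a..b, w t = y b - y a) :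
    IsPrimitiveOn w y Ω := by
  intro a ha b hb
  rcases le_total a b with h | h
  · exact H a ha b hb h
  · obtain ⟨h1, h2⟩ := H b hb a ha h
    refine ⟨h1.symm, ?_⟩
    rw [intervalIntegral.integral_symm, h2]
    ring

theorem IsPrimitiveOn.const_mul {w y : ℝ → ℝ} {Ω : Set ℝ} (H : IsPrimitiveOn w y Ω) (c : ℝ) :
    IsPrimitiveOn (fun x => c * w x) (fun x => c * y x) Ω := by
  intro a ha b hb
  obtain ⟨h1, h2⟩ := H a ha b hb
  refine ⟨h1.const_mul c, ?_⟩
  rw [intervalIntegral.integral_const_mul, h2]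
  ring

theorem IsPrimitiveOn.add_const {w y : ℝ → ℝ} {Ω : Set ℝ} (H : IsPrimitiveOn w y Ω) (c : ℝ) :
    IsPrimitiveOn w (fun x => y x + c) Ω := by
  intro a ha b hb
  obtain ⟨h1, h2⟩ := H a ha b hb
  exact ⟨h1, by rw [h2]; ring⟩

theorem IsPrimitiveOn.congr {w w' y y' : ℝ → ℝ} {Ω : Set ℝ} (hΩ : Ω.OrdConnected)
    (H : IsPrimitiveOn w y Ω) (hw : ∀ x ∈ Ω, w x = w' x) (hy : ∀ x ∈ Ω, y x = y' x) :
    IsPrimitiveOn w' y' Ω := by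
  intro a ha b hb
  obtain ⟨h1, h2⟩ := H a ha b hb
  have hsub : uIcc a b ⊆ Ω := hΩ.uIcc_subset ha hb
  refine ⟨?_, ?_⟩
  · rw [intervalIntegrable_iff'] at h1 ⊢
    exact h1.congr_fun (fun x hx => hw x (hsub hx)) measurableSet_uIcc
  · rw [← hy a ha, ← hy b hb, ← h2]
    exact intervalIntegral.integral_congr fun x hx => (hw x (hsub hx)).symm

/-- A strictly monotone change of variable on an open interval: a primitive of a weight of
constant strict sign. -/
structure StrictPrimitiveOn (w φ : ℝ → ℝ) (Ω : Set ℝ) : Prop where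
  isOpen : IsOpen Ω
  ordConnected : Ω.OrdConnected
  prim : IsPrimitiveOn w φ Ω
  sign : (∀ x ∈ Ω, 0 < w x) ∨ (∀ x ∈ Ω, w x < 0)

namespace StrictPrimitiveOn

variable {w v φ ψ χ : ℝ → ℝ} {Ω : Set ℝ}

theorem congr {w' φ' : ℝ → ℝ} (H : StrictPrimitiveOn w φ Ω) (hw : ∀ x ∈ Ω, w x = w' x)
    (hφ : ∀ x ∈ Ω, φ x = φ' x) : StrictPrimitiveOn w' φ' Ω where
  isOpen := H.isOpen
  ordConnected := H.ordConnected
  prim := H.prim.congr H.ordConnected hw hφ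
  sign := H.sign.imp (fun h x hx => hw x hx ▸ h x hx) (fun h x hx => hw x hx ▸ h x hx)

theorem neg (H : StrictPrimitiveOn w φ Ω) :
    StrictPrimitiveOn (fun x => -w x) (fun x => -φ x) Ω where
  isOpen := H.isOpen
  ordConnected := H.ordConnected
  prim := by simpa using H.prim.const_mul (-1)
  sign := H.sign.symm.imp (fun h x hx => neg_pos.2 (h x hx)) (fun h x hx => neg_neg_of_pos (h x hx))

theorem measurableSet (H : StrictPrimitiveOn w φ Ω) : MeasurableSet Ω := H.isOpen.measurableSet

theorem ne_zero (H : StrictPrimitiveOn w φ Ω) {x : ℝ} (hx : x ∈ Ω) : w x ≠ 0 := by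
  rcases H.sign with h | h
  · exact (h x hx).ne'
  · exact (h x hx).ne

theorem Icc_subset (H : StrictPrimitiveOn w φ Ω) {a b : ℝ} (ha : a ∈ Ω) (hb : b ∈ Ω) :
    Icc a b ⊆ Ω := H.ordConnected.out ha hb

theorem strictMonoOn (H : StrictPrimitiveOn w φ Ω) (hw : ∀ x ∈ Ω, 0 < w x) :
    StrictMonoOn φ Ω := by
  intro a ha b hb hab
  obtain ⟨h1, h2⟩ := H.prim a ha b hb
  have : 0 < ∫ t in a..b, w t := intervalIntegral.intervalIntegral_pos_of_pos_on h1
    (fun x hx => hw x (H.Icc_subset ha hb (Ioo_subset_Icc_self hx))) hab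
  linarith

theorem strictAntiOn (H : StrictPrimitiveOn w φ Ω) (hw : ∀ x ∈ Ω, w x < 0) :
    StrictAntiOn φ Ω := by
  have := H.neg.strictMonoOn fun x hx => neg_pos.2 (hw x hx)
  intro a ha b hb hab
  linarith [this ha hb hab]

theorem injOn (H : StrictPrimitiveOn w φ Ω) : InjOn φ Ω := by
  rcases H.sign with h | h
  · exact (H.strictMonoOn h).injOn
  · exact (H.strictAntiOn h).injOn

theorem exists_Icc_mem_nhds (hΩ : IsOpen Ω) {x : ℝ} (hx : x ∈ Ω) :
    ∃ a b, a < x ∧ x < b ∧ Icc a b ⊆ Ω := by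
  obtain ⟨ε, hε, hsub⟩ := Metric.isOpen_iff.1 hΩ x hx
  refine ⟨x - ε / 2, x + ε / 2, by linarith, by linarith, fun y hy => hsub ?_⟩
  rw [Metric.mem_ball, Real.dist_eq, abs_lt]
  constructor <;> linarith [hy.1, hy.2]

theorem continuousOn (H : StrictPrimitiveOn w φ Ω) : ContinuousOn φ Ω := by
  intro x hx
  obtain ⟨a, b, hax, hxb, hab⟩ := exists_Icc_mem_nhds H.isOpen hx
  have ha : a ∈ Ω := hab ⟨le_rfl, by linarith⟩
  have hb : b ∈ Ω := hab ⟨by linarith, le_rfl⟩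
  have h1 := intervalIntegral.continuousOn_primitive_interval' (H.prim a ha b hb).1 left_mem_uIcc
  rw [uIcc_of_le (by linarith)] at h1
  have h2 : ContinuousOn φ (Icc a b) := by
    refine (h1.add (continuousOn_const (c := φ a))).congr fun y hy => ?_
    exact eq_add_of_sub_eq (H.prim a ha y (hab hy)).2.symm
  exact (h2.continuousAt (Icc_mem_nhds hax hxb)).continuousWithinAt

theorem locallyIntegrableOn (H : StrictPrimitiveOn w φ Ω) : LocallyIntegrableOn w Ω := by
  intro x hx
  obtain ⟨a, b, hax, hxb, hab⟩ := exists_Icc_mem_nhds H.isOpen hx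
  have ha : a ∈ Ω := hab ⟨le_rfl, by linarith⟩
  have hb : b ∈ Ω := hab ⟨by linarith, le_rfl⟩
  have h := (H.prim a ha b hb).1
  rw [intervalIntegrable_iff', uIcc_of_le (by linarith)] at h
  exact ⟨Icc a b, mem_nhdsWithin_of_mem_nhds (Icc_mem_nhds hax hxb), h⟩

theorem aestronglyMeasurable (H : StrictPrimitiveOn w φ Ω) :
    AEStronglyMeasurable w (volume.restrict Ω) :=
  H.locallyIntegrableOn.aestronglyMeasurable

theorem image_uIcc (H : StrictPrimitiveOn w φ Ω) {a b : ℝ} (ha : a ∈ Ω) (hb : b ∈ Ω) :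
    φ '' uIcc a b = uIcc (φ a) (φ b) := by
  have hsub : uIcc a b ⊆ Ω := H.ordConnected.uIcc_subset ha hb
  apply subset_antisymm
  · have key : ∀ x ∈ uIcc a b, φ x ∈ uIcc (φ a) (φ b) := by
      rcases H.sign with h | h
      · exact fun x hx => ((H.strictMonoOn h).monotoneOn.mono hsub).mapsTo_uIcc hx
      · exact fun x hx => ((H.strictAntiOn h).antitoneOn.mono hsub).mapsTo_uIcc hx
    rintro _ ⟨x, hx, rfl⟩
    exact key x hx
  · exact intermediate_value_uIcc (H.continuousOn.mono hsub)

theorem image_ordConnected (H : StrictPrimitiveOn w φ Ω) : (φ '' Ω).OrdConnected :=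
  ordConnected_iff_uIcc_subset.2 <| by
    rintro _ ⟨a, ha, rfl⟩ _ ⟨b, hb, rfl⟩
    rw [← H.image_uIcc ha hb]
    exact image_mono (H.ordConnected.uIcc_subset ha hb)

theorem image_isOpen (H : StrictPrimitiveOn w φ Ω) : IsOpen (φ '' Ω) := by
  rw [isOpen_iff_mem_nhds]
  rintro _ ⟨x, hx, rfl⟩
  obtain ⟨a, b, hax, hxb, hab⟩ := exists_Icc_mem_nhds H.isOpen hx
  have ha : a ∈ Ω := hab ⟨le_rfl, by linarith⟩
  have hb : b ∈ Ω := hab ⟨by linarith, le_rfl⟩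
  have hsub : uIcc (φ a) (φ b) ⊆ φ '' Ω := by
    rw [← H.image_uIcc ha hb, uIcc_of_le (by linarith)]
    exact image_mono hab
  refine Filter.mem_of_superset ?_ hsub
  rcases H.sign with h | h
  · have := H.strictMonoOn h
    exact Filter.mem_of_superset (Icc_mem_nhds (this ha hx hax) (this hx hb hxb)) Icc_subset_uIcc
  · have := H.strictAntiOn h
    exact Filter.mem_of_superset (Icc_mem_nhds (this hx hb hxb) (this ha hx hax)) Icc_subset_uIcc'

theorem measurableEmbedding (H : StrictPrimitiveOn w φ Ω) :
    MeasurableEmbedding (Ω.domRestrict φ) :=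
  H.continuousOn.measurableEmbedding H.measurableSet H.injOn

theorem measurableSet_image (H : StrictPrimitiveOn w φ Ω) {A : Set ℝ} (hA : MeasurableSet A)
    (hAΩ : A ⊆ Ω) : MeasurableSet (φ '' A) :=
  hA.image_of_continuousOn_injOn (H.continuousOn.mono hAΩ) (H.injOn.mono hAΩ)

theorem volume_image_Icc (H : StrictPrimitiveOn w φ Ω) {a b : ℝ} (ha : a ∈ Ω) (hb : b ∈ Ω)
    (hab : a ≤ b) : volume (φ '' Icc a b) = ∫⁻ x in Icc a b, ENNReal.ofReal |w x| := by
  have hsub := H.Icc_subset ha hb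
  obtain ⟨h1, h2⟩ := H.prim a ha b hb
  have h3 : IntegrableOn w (Icc a b) := by
    rwa [intervalIntegrable_iff', uIcc_of_le hab] at h1
  rw [← ofReal_integral_eq_lintegral_ofReal h3.abs
    (Filter.Eventually.of_forall fun _ => abs_nonneg _), ← uIcc_of_le hab, H.image_uIcc ha hb,
    Real.volume_interval, ← h2, uIcc_of_le hab, integral_Icc_eq_integral_Ioc,
    ← intervalIntegral.integral_of_le hab]
  congr 1
  rcases H.sign with h | h
  · rw [abs_of_nonneg]
    · refine intervalIntegral.integral_congr fun x hx => (abs_of_pos (h x ?_)).symm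
      exact hsub (uIcc_of_le hab ▸ hx)
    · exact intervalIntegral.integral_nonneg hab fun x hx => (h x (hsub hx)).le
  · rw [abs_of_nonpos, ← intervalIntegral.integral_neg]
    · refine intervalIntegral.integral_congr fun x hx => (abs_of_neg (h x ?_)).symm
      exact hsub (uIcc_of_le hab ▸ hx)
    · rw [← neg_nonneg, ← intervalIntegral.integral_neg]
      exact intervalIntegral.integral_nonneg hab fun x hx => neg_nonneg.2 (h x (hsub hx)).le

/-- Both measures give a half-open interval the length of its image, and such intervals determine a
locally finite measure. Passing to the subtype `Ω` lets this comparison run over intervals inside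
`Ω` only. No differentiability of `φ` enters, which matters because the weights involve derivatives
not assumed continuous. -/
theorem withDensity_eq_comap (H : StrictPrimitiveOn w φ Ω) :
    ((volume : Measure ℝ).comap ((↑) : Ω → ℝ)).withDensity (fun x => ENNReal.ofReal |w x|) =
      volume.comap (Ω.domRestrict φ) := by
  have : Ω.OrdConnected := H.ordConnected
  have : NoMinOrder Ω := ⟨fun ⟨x, hx⟩ => by
    obtain ⟨a, b, hax, hxb, hab⟩ := exists_Icc_mem_nhds H.isOpen hx
    exact ⟨⟨a, hab ⟨le_rfl, by linarith⟩⟩, hax⟩⟩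
  have key : ∀ a b : Ω, a < b →
      (((volume : Measure ℝ).comap ((↑) : Ω → ℝ)).withDensity
        (fun x => ENNReal.ofReal |w x|)) (Ioc a b) = ∫⁻ x in Icc (a : ℝ) b, ENNReal.ofReal |w x| := by
    intro a b hab
    rw [withDensity_apply _ measurableSet_Ioc,
      setLIntegral_subtype H.measurableSet (Ioc a b) (fun x => ENNReal.ofReal |w x|)]
    have : ((↑) : Ω → ℝ) '' Ioc a b = Ioc (a : ℝ) b := by
      ext x
      simp only [mem_image, Subtype.exists, exists_and_right, exists_eq_right]
      constructor
      · rintro ⟨hx, h1, h2⟩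
        exact ⟨h1, h2⟩
      · rintro ⟨h1, h2⟩
        exact ⟨H.Icc_subset a.2 b.2 ⟨h1.le, h2⟩, h1, h2⟩
    rw [this]
    exact setLIntegral_congr Ioc_ae_eq_Icc
  refine Measure.ext_of_Ioc' _ _ ?_ ?_
  · intro a b hab
    rw [key a b hab, ← H.volume_image_Icc a.2 b.2 hab.le, ← uIcc_of_le (show (a : ℝ) ≤ b from hab.le),
      H.image_uIcc a.2 b.2, Real.volume_interval]
    exact ENNReal.ofReal_ne_top
  · intro a b hab
    rw [key a b hab, ← H.volume_image_Icc a.2 b.2 hab.le,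
      H.measurableEmbedding.comap_apply]
    refine (measure_mono_ae ?_).antisymm (measure_mono ?_)
    -- Closed and half-open intervals have images differing by the single point `φ a`.
    · have h0 : volume ({φ a} : Set ℝ) = 0 := measure_singleton _
      filter_upwards [compl_mem_ae_iff.2 h0] with y hy
      rintro ⟨x, hx, rfl⟩
      refine ⟨⟨x, H.Icc_subset a.2 b.2 hx⟩, ⟨lt_of_le_of_ne hx.1 ?_, hx.2⟩, rfl⟩
      rintro h
      apply hy
      rw [mem_singleton_iff, h]
    · rintro _ ⟨x, hx, rfl⟩
      exact ⟨x, ⟨hx.1.le, hx.2⟩, rfl⟩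

theorem map_withDensity (H : StrictPrimitiveOn w φ Ω) :
    Measure.map (Ω.domRestrict φ) (((volume : Measure ℝ).comap ((↑) : Ω → ℝ)).withDensity
      (fun x => ENNReal.ofReal |w x|)) = volume.restrict (φ '' Ω) := by
  rw [H.withDensity_eq_comap, H.measurableEmbedding.map_comap]
  congr 1
  exact range_domRestrict φ Ω

theorem aemeasurable_subtype (H : StrictPrimitiveOn w φ Ω) :
    AEMeasurable (fun x : Ω => ENNReal.ofReal |w x|)
      ((volume : Measure ℝ).comap ((↑) : Ω → ℝ)) := by
  have h1 : AEMeasurable w (Measure.map ((↑) : Ω → ℝ)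
      ((volume : Measure ℝ).comap ((↑) : Ω → ℝ))) := by
    rw [map_comap_subtype_coe H.measurableSet]
    exact H.aestronglyMeasurable.aemeasurable
  have h2 := h1.comp_measurable measurable_subtype_coe
  exact ENNReal.measurable_ofReal.comp_aemeasurable (measurable_norm.comp_aemeasurable h2)

/-- No measurability of `g` is needed, since `φ` restricts to a measurable embedding; the
transformed densities are specified only pointwise on their supports. -/
theorem lintegral_image (H : StrictPrimitiveOn w φ Ω) (g : ℝ → ℝ≥0∞) :
    ∫⁻ y in φ '' Ω, g y = ∫⁻ x in Ω, ENNReal.ofReal |w x| * g (φ x) := by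
  rw [← H.map_withDensity, H.measurableEmbedding.lintegral_map,
    lintegral_withDensity_eq_lintegral_mul_non_measurable₀ _ H.aemeasurable_subtype
      (Filter.Eventually.of_forall fun _ => ENNReal.ofReal_lt_top)]
  exact lintegral_subtype_comap H.measurableSet (fun x => ENNReal.ofReal |w x| * g (φ x))

theorem integrableOn_image_univ (H : StrictPrimitiveOn w φ Ω) (g : ℝ → ℝ) :
    IntegrableOn g (φ '' Ω) ↔ IntegrableOn (fun x => |w x| * g (φ x)) Ω := by
  rw [IntegrableOn, ← H.map_withDensity, H.measurableEmbedding.integrable_map_iff,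
    integrable_withDensity_iff_integrable_smul₀' H.aemeasurable_subtype
      (Filter.Eventually.of_forall fun _ => ENNReal.ofReal_lt_top), IntegrableOn,
    ← map_comap_subtype_coe H.measurableSet,
    (MeasurableEmbedding.subtype_coe H.measurableSet).integrable_map_iff]
  simp [Function.comp_def]

theorem integral_image_univ (H : StrictPrimitiveOn w φ Ω) (g : ℝ → ℝ) :
    ∫ y in φ '' Ω, g y = ∫ x in Ω, |w x| * g (φ x) := by
  rw [← H.map_withDensity, H.measurableEmbedding.integral_map,
    integral_withDensity_eq_integral_toReal_smul₀ H.aemeasurable_subtype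
      (Filter.Eventually.of_forall fun _ => ENNReal.ofReal_lt_top),
    ← map_comap_subtype_coe H.measurableSet,
    (MeasurableEmbedding.subtype_coe H.measurableSet).integral_map]
  simp [domRestrict]

theorem indicator_image (H : StrictPrimitiveOn w φ Ω) {A : Set ℝ} (hAΩ : A ⊆ Ω) (g : ℝ → ℝ)
    {x : ℝ} (hx : x ∈ Ω) :
    |w x| * (φ '' A).indicator g (φ x) = A.indicator (fun x => |w x| * g (φ x)) x := by
  by_cases hxA : x ∈ A
  · rw [indicator_of_mem hxA, indicator_of_mem (mem_image_of_mem φ hxA)]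
  · rw [indicator_of_notMem hxA, indicator_of_notMem, mul_zero]
    exact fun h => hxA ((H.injOn.mem_image_iff hAΩ hx).1 h)

theorem integrableOn_image (H : StrictPrimitiveOn w φ Ω) {A : Set ℝ} (hA : MeasurableSet A)
    (hAΩ : A ⊆ Ω) (g : ℝ → ℝ) :
    IntegrableOn g (φ '' A) ↔ IntegrableOn (fun x => |w x| * g (φ x)) A := by
  have h := H.integrableOn_image_univ ((φ '' A).indicator g)
  rw [integrableOn_congr_fun (fun x hx => H.indicator_image hAΩ g hx) H.measurableSet,
    integrableOn_indicator_iff (H.measurableSet_image hA hAΩ), integrableOn_indicator_iff hA,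
    inter_eq_left.2 (image_mono hAΩ), inter_eq_left.2 hAΩ] at h
  exact h

theorem integral_image (H : StrictPrimitiveOn w φ Ω) {A : Set ℝ} (hA : MeasurableSet A)
    (hAΩ : A ⊆ Ω) (g : ℝ → ℝ) :
    ∫ y in φ '' A, g y = ∫ x in A, |w x| * g (φ x) := by
  have h := H.integral_image_univ ((φ '' A).indicator g)
  rw [setIntegral_congr_fun H.measurableSet (fun x hx => H.indicator_image hAΩ g hx),
    setIntegral_indicator (H.measurableSet_image hA hAΩ), setIntegral_indicator hA,
    inter_eq_right.2 (image_mono hAΩ), inter_eq_right.2 hAΩ] at h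
  exact h

theorem comp_isPrimitiveOn (H : StrictPrimitiveOn w φ Ω) (G : IsPrimitiveOn v ψ (φ '' Ω)) :
    IsPrimitiveOn (fun x => w x * v (φ x)) (fun x => ψ (φ x)) Ω := by
  refine IsPrimitiveOn.of_le fun a ha b hb hab => ?_
  have hsub := H.Icc_subset ha hb
  obtain ⟨g1, g2⟩ := G _ (mem_image_of_mem φ ha) _ (mem_image_of_mem φ hb)
  rw [intervalIntegrable_iff', ← H.image_uIcc ha hb, uIcc_of_le hab,
    H.integrableOn_image measurableSet_Icc hsub] at g1
  have hint := H.integral_image measurableSet_Icc hsub v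
  rw [← uIcc_of_le hab, H.image_uIcc ha hb, uIcc_of_le hab] at hint
  rw [intervalIntegrable_iff', uIcc_of_le hab, intervalIntegral.integral_of_le hab,
    ← integral_Icc_eq_integral_Ioc]
  rcases H.sign with h | h
  · have e : EqOn (fun x => |w x| * v (φ x)) (fun x => w x * v (φ x)) (Icc a b) := fun x hx => by
      simp only [abs_of_pos (h x (hsub hx))]
    refine ⟨g1.congr_fun e measurableSet_Icc, ?_⟩
    have hφ : φ a ≤ φ b := (H.strictMonoOn h).monotoneOn ha hb hab
    rw [uIcc_of_le hφ, integral_Icc_eq_integral_Ioc, ← intervalIntegral.integral_of_le hφ, g2] at hint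
    rw [hint, setIntegral_congr_fun measurableSet_Icc e]
  · have e : EqOn (fun x => -(|w x| * v (φ x))) (fun x => w x * v (φ x)) (Icc a b) := fun x hx => by
      simp only [abs_of_neg (h x (hsub hx))]
      ring
    refine ⟨g1.neg.congr_fun e measurableSet_Icc, ?_⟩
    have hφ : φ b ≤ φ a := (H.strictAntiOn h).antitoneOn ha hb hab
    rw [uIcc_of_ge hφ, integral_Icc_eq_integral_Ioc, ← intervalIntegral.integral_of_le hφ,
      intervalIntegral.integral_symm, g2] at hint
    rw [← setIntegral_congr_fun measurableSet_Icc e, integral_neg, ← hint, neg_neg]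

theorem comp (H : StrictPrimitiveOn w φ Ω) (G : StrictPrimitiveOn v ψ (φ '' Ω)) :
    StrictPrimitiveOn (fun x => w x * v (φ x)) (fun x => ψ (φ x)) Ω where
  isOpen := H.isOpen
  ordConnected := H.ordConnected
  prim := H.comp_isPrimitiveOn G.prim
  sign := by
    rcases H.sign with h | h <;> rcases G.sign with g | g
    · exact Or.inl fun x hx => mul_pos (h x hx) (g _ (mem_image_of_mem φ hx))
    · exact Or.inr fun x hx => mul_neg_of_pos_of_neg (h x hx) (g _ (mem_image_of_mem φ hx))
    · exact Or.inr fun x hx => mul_neg_of_neg_of_pos (h x hx) (g _ (mem_image_of_mem φ hx))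
    · exact Or.inl fun x hx => mul_pos_of_neg_of_neg (h x hx) (g _ (mem_image_of_mem φ hx))

/-- Pulled back along `φ`, the weight becomes |w| · w⁻¹, the constant ±1, whose integral is the
signed length. -/
theorem inverse (H : StrictPrimitiveOn w φ Ω) (hχ : ∀ x ∈ Ω, χ (φ x) = x) :
    StrictPrimitiveOn (fun y => (w (χ y))⁻¹) χ (φ '' Ω) where
  isOpen := H.image_isOpen
  ordConnected := H.image_ordConnected
  sign := by
    refine H.sign.imp ?_ ?_
    · rintro h _ ⟨x, hx, rfl⟩
      rw [hχ x hx]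
      exact inv_pos.2 (h x hx)
    · rintro h _ ⟨x, hx, rfl⟩
      rw [hχ x hx]
      exact inv_lt_zero.2 (h x hx)
  prim := by
    rintro _ ⟨a, ha, rfl⟩ _ ⟨b, hb, rfl⟩
    have hsub := H.ordConnected.uIcc_subset ha hb
    rw [intervalIntegrable_iff', ← H.image_uIcc ha hb,
      H.integrableOn_image measurableSet_uIcc hsub, hχ a ha, hχ b hb]
    have hint : ∀ a ∈ Ω, ∀ b ∈ Ω, _ := fun a ha b hb => H.integral_image measurableSet_uIcc
      (H.ordConnected.uIcc_subset ha hb) (fun y => (w (χ y))⁻¹)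
    rcases H.sign with h | h
    · have e : ∀ a ∈ Ω, ∀ b ∈ Ω, EqOn (fun x => |w x| * (w (χ (φ x)))⁻¹) (fun _ => (1 : ℝ))
          (uIcc a b) := fun a ha b hb x hx => by
        have hx' := H.ordConnected.uIcc_subset ha hb hx
        simp only [hχ x hx', abs_of_pos (h x hx')]
        exact mul_inv_cancel₀ (h x hx').ne'
      refine ⟨(integrableOn_congr_fun (e a ha b hb) measurableSet_uIcc).2
        (by rw [uIcc]; exact continuousOn_const.integrableOn_Icc), ?_⟩
      have key : ∀ a ∈ Ω, ∀ b ∈ Ω, a ≤ b →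
          ∫ t in φ a..φ b, (w (χ t))⁻¹ = b - a := by
        intro a ha b hb hab
        have h3 := hint a ha b hb
        have hφ : φ a ≤ φ b := (H.strictMonoOn h).monotoneOn ha hb hab
        rw [setIntegral_congr_fun measurableSet_uIcc (e a ha b hb), H.image_uIcc ha hb, uIcc_of_le hφ,
          integral_Icc_eq_integral_Ioc, ← intervalIntegral.integral_of_le hφ] at h3
        rw [h3]
        simp [hab]
      rcases le_total a b with hab | hab
      · exact key a ha b hb hab
      · rw [intervalIntegral.integral_symm, key b hb a ha hab, neg_sub]
    · have e : ∀ a ∈ Ω, ∀ b ∈ Ω, EqOn (fun x => |w x| * (w (χ (φ x)))⁻¹) (fun _ => (-1 : ℝ))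
          (uIcc a b) := fun a ha b hb x hx => by
        have hx' := H.ordConnected.uIcc_subset ha hb hx
        simp only [hχ x hx', abs_of_neg (h x hx'), neg_mul]
        rw [mul_inv_cancel₀ (h x hx').ne]
      refine ⟨(integrableOn_congr_fun (e a ha b hb) measurableSet_uIcc).2
        (by rw [uIcc]; exact continuousOn_const.integrableOn_Icc), ?_⟩
      have key : ∀ a ∈ Ω, ∀ b ∈ Ω, a ≤ b →
          ∫ t in φ a..φ b, (w (χ t))⁻¹ = b - a := by
        intro a ha b hb hab
        have h3 := hint a ha b hb
        have hφ : φ b ≤ φ a := (H.strictAntiOn h).antitoneOn ha hb hab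
        rw [setIntegral_congr_fun measurableSet_uIcc (e a ha b hb), H.image_uIcc ha hb, uIcc_of_ge hφ,
          integral_Icc_eq_integral_Ioc, ← intervalIntegral.integral_of_le hφ] at h3
        rw [intervalIntegral.integral_symm, h3]
        simp [hab]
      rcases le_total a b with hab | hab
      · exact key a ha b hb hab
      · rw [intervalIntegral.integral_symm, key b hb a ha hab, neg_sub]

theorem hasDerivAt (H : StrictPrimitiveOn w φ Ω) {x : ℝ} (hx : x ∈ Ω) (hw : ContinuousOn w Ω) :
    HasDerivAt φ (w x) x := by
  have hd : HasDerivAt (fun u => φ x + ∫ t in x..u, w t) (w x) x :=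
    (intervalIntegral.integral_hasDerivAt_right (H.prim x hx x hx).1
      (hw.stronglyMeasurableAtFilter H.isOpen x hx) (hw.continuousAt (H.isOpen.mem_nhds hx))).const_add _
  refine hd.congr_of_eventuallyEq ?_
  filter_upwards [H.isOpen.mem_nhds hx] with y hy
  rw [(H.prim x hx y hy).2]
  ring

/-- Lebesgue differentiation on each compact interval with rational endpoints; countably many null
sets suffice to treat the whole of `Ω`. -/
theorem ae_hasDerivAt (H : StrictPrimitiveOn w φ Ω) :
    ∀ᵐ x ∂(volume.restrict Ω), HasDerivAt φ (w x) x := by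
  have key : ∀ a b : ℚ, Icc (a : ℝ) b ⊆ Ω → (a : ℝ) < b →
      ∀ᵐ x, x ∈ Ioo (a : ℝ) b → HasDerivAt φ (w x) x := by
    intro a b hab hlt
    have ha : (a : ℝ) ∈ Ω := hab ⟨le_rfl, hlt.le⟩
    have hb : (b : ℝ) ∈ Ω := hab ⟨hlt.le, le_rfl⟩
    filter_upwards [(H.prim a ha b hb).1.ae_hasDerivAt_integral] with x h hx
    have hx' : x ∈ uIcc (a : ℝ) b := by
      rw [uIcc_of_le hlt.le]; exact Ioo_subset_Icc_self hx
    refine ((h hx' a left_mem_uIcc).const_add (φ a)).congr_of_eventuallyEq ?_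
    filter_upwards [H.isOpen.mem_nhds (hab (Ioo_subset_Icc_self hx))] with y hy
    rw [(H.prim a ha y hy).2]
    ring
  have key2 : ∀ᵐ x, ∀ a b : ℚ, Icc (a : ℝ) b ⊆ Ω → (a : ℝ) < b → x ∈ Ioo (a : ℝ) b →
      HasDerivAt φ (w x) x := by
    simp only [ae_all_iff, Filter.eventually_all]
    exact key
  rw [ae_restrict_iff' H.measurableSet]
  filter_upwards [key2] with x hx hxΩ
  obtain ⟨a, b, hax, hxb, hab⟩ := exists_Icc_mem_nhds H.isOpen hxΩ
  obtain ⟨c, hc1, hc2⟩ := exists_rat_btwn hax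
  obtain ⟨d, hd1, hd2⟩ := exists_rat_btwn hxb
  exact hx c d ((Icc_subset_Icc hc1.le hd2.le).trans hab) (hc2.trans hd1) ⟨hc2, hd1⟩

end StrictPrimitiveOn

/-- A locally integrable weight that is integrable at the left end of an interval has the
primitive vanishing there. -/
theorem isPrimitiveOn_setIntegral_Iio {w : ℝ → ℝ} {Ω : Set ℝ}
    (hc : Ω.OrdConnected) (hw : ∀ x ∈ Ω, IntegrableOn w (Ω ∩ Iio x)) :
    IsPrimitiveOn w (fun x => ∫ t in Ω ∩ Iio x, w t) Ω := by
  refine IsPrimitiveOn.of_le fun a ha b hb hab => ?_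
  have hsub : Ico a b ⊆ Ω ∩ Iio b := fun x hx => ⟨hc.out ha hb ⟨hx.1, hx.2.le⟩, hx.2⟩
  have hu : Ω ∩ Iio b = (Ω ∩ Iio a) ∪ Ico a b := by
    ext x
    constructor
    · rintro ⟨h1, h2⟩
      rcases lt_or_ge x a with h | h
      · exact Or.inl ⟨h1, h⟩
      · exact Or.inr ⟨h, h2⟩
    · rintro (⟨h1, h2⟩ | h)
      · exact ⟨h1, lt_of_lt_of_le h2 hab⟩
      · exact hsub h
  have h1 : IntegrableOn w (Ico a b) := (hw b hb).mono_set hsub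
  refine ⟨?_, ?_⟩
  · rwa [intervalIntegrable_iff_integrableOn_Ico_of_le hab]
  · rw [hu, setIntegral_union _ measurableSet_Ico (hw a ha) h1, intervalIntegral.integral_of_le hab,
      ← integral_Icc_eq_integral_Ioc, integral_Icc_eq_integral_Ico]
    · ring
    · rw [disjoint_left]
      exact fun x hx hx' => not_lt.2 hx'.1 hx.2

theorem setIntegral_pos {w : ℝ → ℝ} {Ω : Set ℝ} (hΩ : IsOpen Ω) (hne : Ω.Nonempty)
    (hw : ∀ x ∈ Ω, 0 < w x) (hint : IntegrableOn w Ω) : 0 < ∫ t in Ω, w t := by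
  rw [setIntegral_pos_iff_support_of_nonneg_ae _ hint]
  · refine (hΩ.measure_pos volume hne).trans_le (measure_mono fun x hx => ⟨(hw x hx).ne', hx⟩)
  · exact (ae_restrict_iff' hΩ.measurableSet).2
      (Filter.Eventually.of_forall fun x hx => (hw x hx).le)

/-! ### Transport of moments through the escort and divergence transformations -/

/-- `∫_Ω g^s`, with values in `[0,∞]`. -/
noncomputable def powerMoment (s : ℝ) (Ω : Set ℝ) (g : ℝ → ℝ) : ℝ≥0∞ :=
  ∫⁻ x in Ω, ENNReal.ofReal (g x ^ s)

/-- `∫_Ω (F/h)^t h`, with values in `[0,∞]`. -/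
noncomputable def relPowerMoment (t : ℝ) (Ω : Set ℝ) (F h : ℝ → ℝ) : ℝ≥0∞ :=
  ∫⁻ x in Ω, ENNReal.ofReal ((F x / h x) ^ t * h x)

theorem setLIntegral_ofReal_congr {Ω : Set ℝ} (hΩ : MeasurableSet Ω) {a b c : ℝ → ℝ} (k : ℝ)
    (hk : 0 ≤ k) (hb : ∀ x ∈ Ω, 0 ≤ b x) (h : ∀ x ∈ Ω, a x = k * (b x * c x)) :
    ∫⁻ x in Ω, ENNReal.ofReal (a x) =
      ENNReal.ofReal k * ∫⁻ x in Ω, ENNReal.ofReal (b x) * ENNReal.ofReal (c x) := by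
  rw [← lintegral_const_mul' _ _ ENNReal.ofReal_ne_top]
  refine setLIntegral_congr_fun hΩ fun x hx => ?_
  rw [h x hx, ENNReal.ofReal_mul hk, ENNReal.ofReal_mul (hb x hx)]

/-- Writing every positive factor as an exponential turns an identity between products of real
powers into an identity of exponents, settled by `ring`. -/
theorem exists_eq_exp {x : ℝ} (hx : 0 < x) : ∃ a, x = Real.exp a := ⟨Real.log x, (Real.exp_log hx).symm⟩

section RelEscort

variable {α : ℝ} {h f g : ℝ → ℝ} {Ω Ω' : Set ℝ}

theorem strictPrimitiveOn_relEscort {y : ℝ → ℝ} (hΩ : IsOpen Ω) (hc : Ω.OrdConnected)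
    (hf : ∀ x ∈ Ω, 0 < f x) (hh : ∀ x ∈ Ω, 0 < h x)
    (hy : IsPrimitiveOn (fun x => f x ^ (1 - α) * h x ^ α) y Ω) :
    StrictPrimitiveOn (fun x => f x ^ (1 - α) * h x ^ α) y Ω :=
  ⟨hΩ, hc, hy, Or.inl fun x hx =>
    mul_pos (Real.rpow_pos_of_pos (hf x hx) _) (Real.rpow_pos_of_pos (hh x hx) _)⟩

theorem IsRelEscort.powerMoment_eq (H : IsRelEscort α h Ω f Ω' g) (hΩ : IsOpen Ω)
    (hc : Ω.OrdConnected) (hf : ∀ x ∈ Ω, 0 < f x) (hh : ∀ x ∈ Ω, 0 < h x) :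
    IsOpen Ω' ∧ Ω'.OrdConnected ∧ (∀ y ∈ Ω', 0 < g y) ∧
      ∀ p, powerMoment (1 - p) Ω' g = relPowerMoment (1 - α * p) Ω f h := by
  obtain ⟨y, hy, rfl, hg⟩ := H
  have hy' := strictPrimitiveOn_relEscort hΩ hc hf hh hy
  refine ⟨hy'.image_isOpen, hy'.image_ordConnected, ?_, fun p => ?_⟩
  · rintro _ ⟨x, hx, rfl⟩
    rw [hg x hx]
    exact Real.rpow_pos_of_pos (div_pos (hf x hx) (hh x hx)) _
  · rw [powerMoment, hy'.lintegral_image, relPowerMoment]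
    refine setLIntegral_congr_fun hΩ.measurableSet fun x hx => ?_
    rw [hg x hx, ← ENNReal.ofReal_mul (abs_nonneg _)]
    congr 1
    obtain ⟨a, ha⟩ := exists_eq_exp (hf x hx)
    obtain ⟨b, hb⟩ := exists_eq_exp (hh x hx)
    rw [ha, hb, abs_of_pos (by positivity)]
    simp only [← Real.exp_sub, ← Real.exp_mul, ← Real.exp_add]
    congr 1
    ring

theorem not_isOpen_of_subset_singleton {c : ℝ} (hΩ : IsOpen Ω) (hne : Ω.Nonempty) :
    ¬ Ω ⊆ {c} := fun hs => by
  have h1 := hΩ.measure_pos volume hne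
  have h2 := measure_mono (μ := volume) hs
  simp only [Real.volume_singleton] at h2
  exact absurd h1 (not_lt.2 h2)

theorem IsRelEscortInv.exists_strictPrimitiveOn (H : IsRelEscortInv α h Ω' g Ω f)
    (hΩ : IsOpen Ω) (hc : Ω.OrdConnected) (hΩ' : IsOpen Ω') (hne' : Ω'.Nonempty)
    (hg : ∀ x ∈ Ω', 0 < g x) (hh : ∀ x ∈ Ω, 0 < h x) :
    ∃ r, 0 < r ∧ ∃ z : ℝ → ℝ,
      StrictPrimitiveOn (fun x => r * ((r * g (z x)) ^ (-((α - 1) / α)) * h x)) z Ω ∧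
      z '' Ω = Ω' ∧ ∀ x ∈ Ω, f x = (r * g (z x)) ^ (1 / α) * h x := by
  obtain ⟨-, r, hr, y, hy, hz, hF⟩ := H
  have hr0 : 0 < r := by
    -- With `r = 0` the map x ↦ r y(x) would be constant, so its image could not be the nonempty
    -- open set `Ω'`.
    refine lt_of_le_of_ne (hr ▸ ENNReal.toReal_nonneg) fun h0 => ?_
    apply not_isOpen_of_subset_singleton (c := 0) hΩ' hne'
    rw [← hz, ← h0]
    rintro _ ⟨x, -, rfl⟩
    simp
  refine ⟨r, hr0, fun x => r * y x, ⟨hΩ, hc, hy.const_mul r, Or.inl fun x hx => ?_⟩, hz, hF⟩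
  have : 0 < g (r * y x) := hg _ (hz ▸ mem_image_of_mem (fun x => r * y x) hx)
  exact mul_pos hr0 (mul_pos (Real.rpow_pos_of_pos (mul_pos hr0 this) _) (hh x hx))

theorem IsRelEscortInv.relPowerMoment_eq (H : IsRelEscortInv α h Ω' g Ω f) (hα : 0 < α)
    (hΩ : IsOpen Ω) (hc : Ω.OrdConnected) (hΩ' : IsOpen Ω') (hne' : Ω'.Nonempty)
    (hg : ∀ x ∈ Ω', 0 < g x) (hh : ∀ x ∈ Ω, 0 < h x) :
    (∀ x ∈ Ω, 0 < f x) ∧ ∃ r, 0 < r ∧ ∀ p, relPowerMoment (1 - α * p) Ω f h =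
      ENNReal.ofReal (r ^ (-p)) * powerMoment (1 - p) Ω' g := by
  obtain ⟨r, hr, z, hz, rfl, hf⟩ := H.exists_strictPrimitiveOn hΩ hc hΩ' hne' hg hh
  have hgz : ∀ x ∈ Ω, 0 < g (z x) := fun x hx => hg _ (mem_image_of_mem z hx)
  refine ⟨fun x hx => ?_, r, hr, fun p => ?_⟩
  · rw [hf x hx]
    exact mul_pos (Real.rpow_pos_of_pos (mul_pos hr (hgz x hx)) _) (hh x hx)
  · rw [powerMoment, hz.lintegral_image, relPowerMoment]
    refine setLIntegral_ofReal_congr hΩ.measurableSet _ (Real.rpow_nonneg hr.le _)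
      (fun x _ => abs_nonneg _) fun x hx => ?_
    rw [hf x hx]
    obtain ⟨a, ha⟩ := exists_eq_exp (hgz x hx)
    obtain ⟨b, hb⟩ := exists_eq_exp (hh x hx)
    obtain ⟨c, hc⟩ := exists_eq_exp hr
    rw [ha, hb, hc, abs_of_pos (by positivity)]
    simp only [← Real.exp_sub, ← Real.exp_mul, ← Real.exp_add]
    congr 1
    field_simp
    ring

end RelEscort

/-- The defining relation reads H(y) = K⁻¹P with H and P the primitives of `h` and of h^δ F^(1-δ),
so y = H⁻¹ ∘ K⁻¹P and its weight comes from the composition and inverse rules. -/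
theorem IsDivergenceTransform.exists_strictPrimitiveOn {δ : ℝ} {h F F' : ℝ → ℝ} {Ω : Set ℝ}
    (H : IsDivergenceTransform δ h Ω F F') (hΩ : IsOpen Ω) (hc : Ω.OrdConnected)
    (hne : Ω.Nonempty) (hh : ∀ x ∈ Ω, 0 < h x) (hhint : IntegrableOn h Ω)
    (hF : ∀ x ∈ Ω, 0 < F x) :
    ∃ K, 0 < K ∧ ∃ y : ℝ → ℝ,
      StrictPrimitiveOn (fun x => K⁻¹ * (h x ^ δ * F x ^ (1 - δ)) * (h (y x))⁻¹) y Ω ∧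
      y '' Ω = Ω ∧ ∀ x ∈ Ω, F' (y x) = K * (F x / h x) ^ δ * h (y x) := by
  obtain ⟨hint, K, hK, y, hbij, hy, hF'⟩ := H
  have hpos : ∀ x ∈ Ω, 0 < h x ^ δ * F x ^ (1 - δ) := fun x hx =>
    mul_pos (Real.rpow_pos_of_pos (hh x hx) _) (Real.rpow_pos_of_pos (hF x hx) _)
  have hK0 : 0 < K := hK ▸ setIntegral_pos hΩ hne hpos hint
  have hH : StrictPrimitiveOn h (fun x => ∫ t in Ω ∩ Iio x, h t) Ω :=
    ⟨hΩ, hc, isPrimitiveOn_setIntegral_Iio hc fun x _ => hhint.mono_set inter_subset_left,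
      Or.inl hh⟩
  have hP : StrictPrimitiveOn (fun x => K⁻¹ * (h x ^ δ * F x ^ (1 - δ)))
      (fun x => K⁻¹ * ∫ t in Ω ∩ Iio x, h t ^ δ * F t ^ (1 - δ)) Ω :=
    ⟨hΩ, hc, (isPrimitiveOn_setIntegral_Iio hc fun x _ =>
      hint.mono_set inter_subset_left).const_mul _,
      Or.inl fun x hx => mul_pos (inv_pos.2 hK0) (hpos x hx)⟩
  have hχ : ∀ x ∈ Ω, Function.invFunOn (fun x => ∫ t in Ω ∩ Iio x, h t) Ω
      ((fun x => ∫ t in Ω ∩ Iio x, h t) x) = x := fun x hx => hH.injOn.leftInvOn_invFunOn hx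
  have himg : (fun x => ∫ t in Ω ∩ Iio x, h t) '' Ω =
      (fun x => K⁻¹ * ∫ t in Ω ∩ Iio x, h t ^ δ * F t ^ (1 - δ)) '' Ω := by
    rw [← image_congr hy, ← image_image (fun x => ∫ t in Ω ∩ Iio x, h t) y, hbij.image_eq]
  have hinv := hH.inverse hχ
  rw [himg] at hinv
  have hyeq : ∀ x ∈ Ω, Function.invFunOn (fun x => ∫ t in Ω ∩ Iio x, h t) Ω
      (K⁻¹ * ∫ t in Ω ∩ Iio x, h t ^ δ * F t ^ (1 - δ)) = y x := fun x hx => by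
    rw [← hy x hx]
    exact hχ _ (hbij.mapsTo hx)
  refine ⟨K, hK0, y, (hP.comp hinv).congr (fun x hx => ?_) hyeq, hbij.image_eq, hF'⟩
  simp only [hyeq x hx]

/-- With q = F/h, the ratio F'/h pulls back to K q^δ and the measure h dy to K⁻¹ q^(1-δ) h dx; the
exponent of q becomes δ(1-t) + 1 - δ = 1 - δt. This is where the order is dilated by δ. -/
theorem IsDivergenceTransform.relPowerMoment_eq {δ : ℝ} {h F F' : ℝ → ℝ} {Ω : Set ℝ}
    (H : IsDivergenceTransform δ h Ω F F') (hΩ : IsOpen Ω) (hc : Ω.OrdConnected)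
    (hne : Ω.Nonempty) (hh : ∀ x ∈ Ω, 0 < h x) (hhint : IntegrableOn h Ω)
    (hF : ∀ x ∈ Ω, 0 < F x) :
    (∀ x ∈ Ω, 0 < F' x) ∧ ∃ K, 0 < K ∧ ∀ t, relPowerMoment (1 - t) Ω F' h =
      ENNReal.ofReal (K ^ (-t)) * relPowerMoment (1 - δ * t) Ω F h := by
  obtain ⟨K, hK, y, hy, himg, hF'⟩ := H.exists_strictPrimitiveOn hΩ hc hne hh hhint hF
  have hhy : ∀ x ∈ Ω, 0 < h (y x) := fun x hx => hh _ (himg ▸ mem_image_of_mem y hx)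
  refine ⟨?_, K, hK, fun t => ?_⟩
  · rw [← himg]
    rintro _ ⟨x, hx, rfl⟩
    rw [hF' x hx]
    have := div_pos (hF x hx) (hh x hx)
    have := hhy x hx
    positivity
  · have h1 : relPowerMoment (1 - t) Ω F' h =
        ∫⁻ x in y '' Ω, ENNReal.ofReal ((F' x / h x) ^ (1 - t) * h x) := by
      rw [himg, relPowerMoment]
    rw [h1, hy.lintegral_image, relPowerMoment,
      ← lintegral_const_mul' _ _ ENNReal.ofReal_ne_top]
    refine setLIntegral_congr_fun hΩ.measurableSet fun x hx => ?_
    rw [← ENNReal.ofReal_mul (abs_nonneg _), ← ENNReal.ofReal_mul (Real.rpow_nonneg hK.le _),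
      hF' x hx]
    congr 1
    obtain ⟨a, ha⟩ := exists_eq_exp (hhy x hx)
    obtain ⟨b, hb⟩ := exists_eq_exp (hh x hx)
    obtain ⟨c, hc⟩ := exists_eq_exp hK
    obtain ⟨d, hd⟩ := exists_eq_exp (hF x hx)
    rw [ha, hb, hc, hd, abs_of_pos (by positivity)]
    simp only [← Real.exp_sub, ← Real.exp_mul, ← Real.exp_add, ← Real.exp_neg]
    congr 1
    ring

/-! ### Fisher integrals as power moments: the down and up steps, and the full composition -/

theorem IsRelEscort.down_powerMoment_eq {α γ : ℝ} {h f g₁ g₂ : ℝ → ℝ} {Ω Ω₁ Ω₂ : Set ℝ}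
    (H₁ : IsRelEscort α h Ω f Ω₁ g₁) (H₂ : IsDown γ Ω₁ g₁ Ω₂ g₂) (hα : 0 < α)
    (hΩ : IsOpen Ω) (hc : Ω.OrdConnected) (hne : Ω.Nonempty)
    (hf : ∀ x ∈ Ω, 0 < f x) (hh : ∀ x ∈ Ω, 0 < h x)
    (hfd : ∀ x ∈ Ω, DifferentiableAt ℝ f x) (hhd : ∀ x ∈ Ω, DifferentiableAt ℝ h x)
    (hdec : ∀ x ∈ Ω, deriv (fun t => f t / h t) x < 0) :
    IsOpen Ω₂ ∧ Ω₂.OrdConnected ∧ Ω₂.Nonempty ∧ (∀ x ∈ Ω₂, 0 < g₂ x) ∧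
      ∀ p, relFisherIntegral p (α * (2 - γ)) Ω f h =
        ENNReal.ofReal (α ^ (-p)) * powerMoment (1 - p) Ω₂ g₂ := by
  obtain ⟨y, hy, rfl, hg₁⟩ := H₁
  obtain ⟨hdiff, s, hs, rfl, hg₂⟩ := H₂
  have hy' := strictPrimitiveOn_relEscort hΩ hc hf hh hy
  have hwc : ContinuousOn (fun x => f x ^ (1 - α) * h x ^ α) Ω := fun x hx =>
    (((hfd x hx).continuousAt.rpow_const (Or.inl (hf x hx).ne')).mul
      ((hhd x hx).continuousAt.rpow_const (Or.inl (hh x hx).ne'))).continuousWithinAt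
  have hg₁pos : ∀ x ∈ y '' Ω, 0 < g₁ x := by
    rintro _ ⟨x, hx, rfl⟩
    rw [hg₁ x hx]
    exact Real.rpow_pos_of_pos (div_pos (hf x hx) (hh x hx)) _
  have hs' : StrictPrimitiveOn (fun x => g₁ x ^ (1 - γ) * |deriv g₁ x|) s (y '' Ω) :=
    ⟨hy'.image_isOpen, hy'.image_ordConnected, hs, Or.inl fun x hx =>
      mul_pos (Real.rpow_pos_of_pos (hg₁pos x hx) _) (abs_pos.2 (hdiff x hx).2.ne)⟩
  refine ⟨hs'.image_isOpen, hs'.image_ordConnected, (hne.image y).image s, ?_, fun p => ?_⟩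
  · rintro _ ⟨x, hx, rfl⟩
    rw [hg₂ x hx]
    exact mul_pos (Real.rpow_pos_of_pos (hg₁pos x hx) _) (inv_pos.2 (abs_pos.2 (hdiff x hx).2.ne))
  · rw [powerMoment, hs'.lintegral_image, hy'.lintegral_image, relFisherIntegral,
      ← lintegral_const_mul' _ _ ENNReal.ofReal_ne_top]
    refine setLIntegral_congr_fun hΩ.measurableSet fun x hx => ?_
    have hq : 0 < f x / h x := div_pos (hf x hx) (hh x hx)
    have hqd : HasDerivAt (fun t => f t / h t) (deriv (fun t => f t / h t) x) x :=
      ((hfd x hx).div (hhd x hx) (hh x hx).ne').hasDerivAt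
    have hlog : deriv (fun t => Real.log (f t / h t)) x =
        deriv (fun t => f t / h t) x / (f x / h x) := (hqd.log hq.ne').deriv
    have hyx := mem_image_of_mem y hx
    -- Two computations of the derivative of g₁ ∘ y = (f/h)^α; this is how (log (f/h))' enters the
    -- power moment of `g₂`.
    have hchain : deriv g₁ (y x) * (f x ^ (1 - α) * h x ^ α) =
        deriv (fun t => f t / h t) x * α * (f x / h x) ^ (α - 1) := by
      have h1 := (hdiff _ hyx).1.hasDerivAt.comp x (hy'.hasDerivAt hx hwc)
      have h2 := hqd.rpow_const (p := α) (Or.inl hq.ne')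
      refine (h1.congr_of_eventuallyEq ?_).unique h2
      filter_upwards [hΩ.mem_nhds hx] with t ht
      exact (hg₁ t ht).symm
    rw [hg₂ _ hyx, hg₁ x hx, hlog]
    set D := deriv (fun t => f t / h t) x with hD
    have hDneg : D < 0 := hdec x hx
    have hw : 0 < f x ^ (1 - α) * h x ^ α :=
      mul_pos (Real.rpow_pos_of_pos (hf x hx) _) (Real.rpow_pos_of_pos (hh x hx) _)
    have hg' : |deriv g₁ (y x)| =
        α * ((f x / h x) ^ (α - 1) * |D| / (f x ^ (1 - α) * h x ^ α)) := by
      rw [eq_div_of_mul_eq hw.ne' hchain, abs_div, abs_mul, abs_mul, abs_of_pos hw,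
        abs_of_pos hα, abs_of_pos (Real.rpow_pos_of_pos hq _)]
      ring
    obtain ⟨a, ha⟩ := exists_eq_exp (hf x hx)
    obtain ⟨b, hb⟩ := exists_eq_exp (hh x hx)
    obtain ⟨d, hd⟩ := exists_eq_exp (abs_pos.2 hDneg.ne)
    rw [hg', abs_div, abs_of_pos hq, ENNReal.ofReal_rpow_of_pos (div_pos (abs_pos.2 hDneg.ne) hq)]
    rw [ha, hb, hd]
    simp only [← Real.exp_sub, ← Real.exp_mul, ← Real.exp_add]
    rw [← ENNReal.ofReal_mul (by positivity), ← ENNReal.ofReal_mul (by positivity),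
      ← ENNReal.ofReal_mul (by positivity), ← ENNReal.ofReal_mul (by positivity)]
    congr 1
    obtain ⟨l, hl⟩ := exists_eq_exp hα
    have e1 : ∀ t : ℝ, α * Real.exp t = Real.exp (l + t) := fun t => by
      rw [Real.exp_add, ← hl]
    have e2 : α ^ (-p) = Real.exp (l * -p) := by
      rw [Real.exp_mul, ← hl]
    rw [e1, e2, abs_of_pos (by positivity), abs_of_pos (by positivity)]
    simp only [← Real.exp_mul, ← Real.exp_add, ← Real.exp_neg]
    congr 1
    ring

/-- Let `x₅` be the change of variable from `Ω` back to `Ω₅`. Then log (k/h) is a constant plus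
(1/θ) log |x₅|, so its derivative is x₅'/(θ x₅). Since `x₅` is known to be differentiable only
almost everywhere, the integrands are compared almost everywhere. -/
theorem IsUp.inv_relFisherIntegral_eq {α γ : ℝ} {h k g₅ g₆ : ℝ → ℝ} {Ω Ω₅ Ω₆ : Set ℝ}
    (H₁ : IsUp γ Ω₅ g₅ Ω₆ g₆) (H₂ : IsRelEscortInv α h Ω₆ g₆ Ω k) (hα : 0 < α) (hγ : γ ≠ 2)
    (hΩ : IsOpen Ω) (hc : Ω.OrdConnected) (hΩ₅ : IsOpen Ω₅) (hc₅ : Ω₅.OrdConnected)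
    (hne₅ : Ω₅.Nonempty) (hg₅ : ∀ x ∈ Ω₅, 0 < g₅ x) (hh : ∀ x ∈ Ω, 0 < h x) :
    ∃ c, 0 < c ∧ ∀ p, relFisherIntegral p (α * (2 - γ)) Ω k h =
        ENNReal.ofReal (c ^ p) * powerMoment (1 - p) Ω₅ g₅ := by
  obtain ⟨h0, u, hu, hu_img, hg₆⟩ := H₁
  have hγ' : γ - 2 ≠ 0 := sub_ne_zero.2 hγ
  have hA : ∀ x ∈ Ω₅, 0 < |(γ - 2) * x| := fun x hx =>
    abs_pos.2 (mul_ne_zero hγ' fun h => h0 (h ▸ hx))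
  have hu' : StrictPrimitiveOn (fun x => -(|(γ - 2) * x| ^ (1 / (γ - 2)) * g₅ x)) u Ω₅ :=
    ⟨hΩ₅, hc₅, hu, Or.inr fun x hx =>
      neg_neg_of_pos (mul_pos (Real.rpow_pos_of_pos (hA x hx) _) (hg₅ x hx))⟩
  have hg₆pos : ∀ x ∈ Ω₆, 0 < g₆ x := by
    rw [← hu_img]
    rintro _ ⟨x, hx, rfl⟩
    rw [hg₆ x hx]
    exact Real.rpow_pos_of_pos (hA x hx) _
  obtain ⟨r, hr, z, hz, hz_img, hk⟩ := H₂.exists_strictPrimitiveOn hΩ hc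
    (hu_img ▸ hu'.image_isOpen) (hu_img ▸ hne₅.image u) hg₆pos hh
  have hχ : ∀ x ∈ Ω₅, Function.invFunOn u Ω₅ (u x) = x := fun x hx =>
    hu'.injOn.leftInvOn_invFunOn hx
  have hinv := hu'.inverse hχ
  rw [hu_img, ← hz_img] at hinv
  set x₅ : ℝ → ℝ := fun v => Function.invFunOn u Ω₅ (z v) with hx₅
  have hcomp := hz.comp hinv
  have hmem : ∀ v ∈ Ω, x₅ v ∈ Ω₅ ∧ u (x₅ v) = z v := fun v hv => by
    have : z v ∈ u '' Ω₅ := by rw [hu_img, ← hz_img]; exact mem_image_of_mem z hv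
    exact ⟨Function.invFunOn_mem this, Function.invFunOn_eq this⟩
  have himg : x₅ '' Ω = Ω₅ := by
    rw [hx₅, ← image_image (Function.invFunOn u Ω₅) z, hz_img, ← hu_img]
    exact hu'.injOn.leftInvOn_invFunOn.image_image
  have hg₆z : ∀ v ∈ Ω, g₆ (z v) = |(γ - 2) * x₅ v| ^ (1 / (2 - γ)) := fun v hv => by
    rw [← (hmem v hv).2, hg₆ _ (hmem v hv).1]
  refine ⟨α⁻¹ * r ^ (2 - γ), by positivity, fun p => ?_⟩
  rw [powerMoment, ← himg, hcomp.lintegral_image, relFisherIntegral,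
    ← lintegral_const_mul' _ _ ENNReal.ofReal_ne_top]
  refine setLIntegral_congr_fun_ae hΩ.measurableSet ?_
  have hae := hcomp.ae_hasDerivAt
  rw [ae_restrict_iff' hΩ.measurableSet] at hae
  filter_upwards [hae] with v hv hvΩ
  have hd := hv hvΩ
  obtain ⟨hx5, -⟩ := hmem v hvΩ
  have hx5ne : x₅ v ≠ 0 := fun h => h0 (h ▸ hx5)
  have hlog : deriv (fun t => Real.log (k t / h t)) v =
      1 / (α * (2 - γ)) * (r * ((r * g₆ (z v)) ^ (-((α - 1) / α)) * h v) *
        (-(|(γ - 2) * x₅ v| ^ (1 / (γ - 2)) * g₅ (x₅ v)))⁻¹ / x₅ v) := by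
    refine HasDerivAt.deriv ?_
    refine (((hd.log hx5ne).const_mul (1 / (α * (2 - γ)))).const_add
      (1 / α * (Real.log r + 1 / (2 - γ) * Real.log |γ - 2|))).congr_of_eventuallyEq ?_
    filter_upwards [hΩ.mem_nhds hvΩ] with t ht
    have hAt := hA _ (hmem t ht).1
    have hxt : x₅ t ≠ 0 := fun h => h0 (h ▸ (hmem t ht).1)
    have hγ'' : (2 - γ) ≠ 0 := sub_ne_zero.2 hγ.symm
    rw [hk t ht, mul_div_assoc, div_self (hh t ht).ne', mul_one, hg₆z t ht,
      Real.log_rpow (by positivity), Real.log_mul hr.ne' (by positivity), Real.log_rpow hAt,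
      abs_mul, Real.log_mul (abs_ne_zero.2 hγ') (abs_ne_zero.2 hxt), Real.log_abs (x₅ t)]
    field_simp
    ring
  have hB := hA _ hx5
  have hx5B : |x₅ v| = |(γ - 2) * x₅ v| / |γ - 2| := by
    rw [abs_mul]
    field_simp
  have hgv := hg₅ _ hx5
  have hhv := hh v hvΩ
  change _ * ENNReal.ofReal |deriv (fun t => Real.log (k t / h t)) v| ^ p = _
  rw [hlog, hk v hvΩ, hg₆z v hvΩ]
  change _ = _ * (ENNReal.ofReal
    |r * ((r * |(γ - 2) * x₅ v| ^ (1 / (2 - γ))) ^ (-((α - 1) / α)) * h v) *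
      (-(|(γ - 2) * x₅ v| ^ (1 / (γ - 2)) * g₅ (x₅ v)))⁻¹| * ENNReal.ofReal (g₅ (x₅ v) ^ (1 - p)))
  rw [abs_mul (1 / _), abs_div _ (x₅ v), abs_mul _ (-_)⁻¹, abs_inv, abs_neg, hx5B,
    abs_of_pos (show 0 < r * ((r * |(γ - 2) * x₅ v| ^ (1 / (2 - γ))) ^ (-((α - 1) / α)) * h v) by
      positivity),
    abs_of_pos (show 0 < |(γ - 2) * x₅ v| ^ (1 / (γ - 2)) * g₅ (x₅ v) by positivity), abs_div,
    abs_one, abs_mul α, abs_of_pos hα, abs_sub_comm 2 γ]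
  set B := |(γ - 2) * x₅ v|
  have hγ2 : 0 < |γ - 2| := abs_pos.2 hγ'
  obtain ⟨b, hb⟩ := exists_eq_exp hB
  obtain ⟨g, hg⟩ := exists_eq_exp hgv
  obtain ⟨ρ, hρ⟩ := exists_eq_exp hr
  obtain ⟨η, hη⟩ := exists_eq_exp hhv
  obtain ⟨l, hl⟩ := exists_eq_exp hα
  obtain ⟨m, hm⟩ := exists_eq_exp hγ2
  have e1 : 1 / (α * |γ - 2|) = Real.exp (-(l + m)) := by
    rw [Real.exp_neg, Real.exp_add, ← hl, ← hm, one_div]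
  have e2 : α⁻¹ = Real.exp (-l) := by rw [Real.exp_neg, ← hl]
  have hγ'' : (2 - γ) ≠ 0 := sub_ne_zero.2 hγ.symm
  rw [e1, e2, hb, hg, hρ, hη, hm]
  simp only [← Real.exp_sub, ← Real.exp_mul, ← Real.exp_add, ← Real.exp_neg]
  rw [ENNReal.ofReal_rpow_of_pos (by positivity), ← ENNReal.ofReal_mul (by positivity),
    ← ENNReal.ofReal_mul (by positivity), ← ENNReal.ofReal_mul (by positivity)]
  simp only [← Real.exp_mul, ← Real.exp_add]
  congr 2
  have e3 : γ - 2 = -(2 - γ) := by ring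
  rw [e3, div_neg]
  field_simp
  ring

theorem DensityPair.f_integrableOn {Ω : Set ℝ} {f h : ℝ → ℝ} (H : DensityPair Ω f h) :
    IntegrableOn f Ω := by
  by_contra hn
  have := H.f_integral
  rw [integral_undef hn] at this
  exact zero_ne_one this

theorem DensityPair.h_integrableOn {Ω : Set ℝ} {f h : ℝ → ℝ} (H : DensityPair Ω f h) :
    IntegrableOn h Ω := by
  by_contra hn
  have := H.h_integral
  rw [integral_undef hn] at this
  exact zero_ne_one this

theorem DensityPair.nonempty {Ω : Set ℝ} {f h : ℝ → ℝ} (H : DensityPair Ω f h) :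
    Ω.Nonempty := by
  rw [nonempty_iff_ne_empty]
  rintro rfl
  simpa using H.f_integral

/-- The factors of the five moment identities are all of the form (constant)^p and merge into one `c
^ p`. The constant depends on the version; the dilation `δ * p` does not. -/
theorem IsConjugatedTransform.relFisherIntegral_eq {α γ δ : ℝ} {h f k : ℝ → ℝ} {Ω : Set ℝ}
    (H : IsConjugatedTransform γ α δ h Ω f k) (hfh : DensityPair Ω f h) (hα : 0 < α) (hγ : γ ≠ 2)
    (hfd : ∀ x ∈ Ω, DifferentiableAt ℝ f x) (hhd : ∀ x ∈ Ω, DifferentiableAt ℝ h x)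
    (hdec : ∀ x ∈ Ω, deriv (fun t => f t / h t) x < 0) :
    ∃ c, 0 < c ∧ ∀ p, relFisherIntegral p (α * (2 - γ)) Ω k h =
      ENNReal.ofReal (c ^ p) * relFisherIntegral (δ * p) (α * (2 - γ)) Ω f h := by
  obtain ⟨F, F', ⟨Ω₁, Ω₂, g₁, g₂, H₁, H₂, H₃⟩, H₄, Ω₅, Ω₆, g₅, g₆, H₅, H₆, H₇⟩ := H
  have hΩ := hfh.isOpen
  have hc := hfh.ordConnected
  have hne := hfh.nonempty
  have hh := hfh.h_pos
  obtain ⟨hΩ₂, -, hne₂, hg₂, e₂⟩ :=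
    H₁.down_powerMoment_eq H₂ hα hΩ hc hne hfh.f_pos hh hfd hhd hdec
  obtain ⟨hF, r, hr, e₃⟩ := H₃.relPowerMoment_eq hα hΩ hc hΩ₂ hne₂ hg₂ hh
  obtain ⟨hF', K, hK, e₄⟩ := H₄.relPowerMoment_eq hΩ hc hne hh hfh.h_integrableOn hF
  obtain ⟨hΩ₅, hc₅, hg₅, e₅⟩ := H₅.powerMoment_eq hΩ hc hF' hh
  have hne₅ : Ω₅.Nonempty := by
    obtain ⟨y, -, rfl, -⟩ := H₅
    exact hne.image y
  obtain ⟨c, hc0, e₇⟩ := H₆.inv_relFisherIntegral_eq H₇ hα hγ hΩ hc hΩ₅ hc₅ hne₅ hg₅ hh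
  refine ⟨c * K ^ (-α) * r ^ (-δ) * α ^ δ, by positivity, fun p => ?_⟩
  rw [e₇, e₅, e₄, mul_left_comm δ α p, e₃, e₂, ← mul_assoc, ← mul_assoc, ← mul_assoc,
    ← ENNReal.ofReal_mul (by positivity), ← ENNReal.ofReal_mul (by positivity),
    ← ENNReal.ofReal_mul (by positivity)]
  congr 2
  obtain ⟨a, ha⟩ := exists_eq_exp hα
  obtain ⟨b, hb⟩ := exists_eq_exp hK
  obtain ⟨d, hd⟩ := exists_eq_exp hr
  obtain ⟨l, hl⟩ := exists_eq_exp hc0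
  rw [hb, hd, hl]
  have e1 : α ^ δ = Real.exp (a * δ) := by rw [Real.exp_mul, ← ha]
  have e2 : α ^ (-(δ * p)) = Real.exp (a * -(δ * p)) := by rw [Real.exp_mul, ← ha]
  rw [e1, e2]
  simp only [← Real.exp_mul, ← Real.exp_add]
  congr 1
  ring

/-! ### The Fisher integral as a log-convex function of its order -/

section RelFisher

variable {θ : ℝ} {Ω : Set ℝ} {f h : ℝ → ℝ}

/-- Collects all dependence on `p` into the power of one function, so that Hölder applies in the
order. -/
theorem relFisherIntegral_eq_lintegral (hΩ : MeasurableSet Ω) (hf : ∀ x ∈ Ω, 0 < f x)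
    (hh : ∀ x ∈ Ω, 0 < h x) (hd : ∀ x ∈ Ω, deriv (fun t => Real.log (f t / h t)) x ≠ 0) (p : ℝ) :
    relFisherIntegral p θ Ω f h = ∫⁻ x in Ω, ENNReal.ofReal (f x) *
      ENNReal.ofReal (f x ^ (θ - 1) * h x ^ (-θ) *
        |deriv (fun t => Real.log (f t / h t)) x|) ^ p := by
  refine setLIntegral_congr_fun hΩ fun x hx => ?_
  have hfx := hf x hx
  have hhx := hh x hx
  have hdx := abs_pos.2 (hd x hx)
  rw [ENNReal.ofReal_rpow_of_pos hdx, ENNReal.ofReal_rpow_of_pos (by positivity),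
    ← ENNReal.ofReal_mul (by positivity), ← ENNReal.ofReal_mul hfx.le,
    Real.mul_rpow (by positivity) hdx.le, ← mul_assoc]
  congr 2
  obtain ⟨a, ha⟩ := exists_eq_exp hfx
  obtain ⟨b, hb⟩ := exists_eq_exp hhx
  rw [ha, hb]
  simp only [← Real.exp_mul, ← Real.exp_add]
  congr 1
  ring

theorem DensityPair.deriv_log_div_ne_zero (hfh : DensityPair Ω f h)
    (hfd : ∀ x ∈ Ω, DifferentiableAt ℝ f x) (hhd : ∀ x ∈ Ω, DifferentiableAt ℝ h x)
    (hdec : ∀ x ∈ Ω, deriv (fun t => f t / h t) x < 0) {x : ℝ} (hx : x ∈ Ω) :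
    deriv (fun t => Real.log (f t / h t)) x ≠ 0 := by
  have hq : 0 < f x / h x := div_pos (hfh.f_pos x hx) (hfh.h_pos x hx)
  have hqd : HasDerivAt (fun t => f t / h t) (deriv (fun t => f t / h t) x) x :=
    ((hfd x hx).div (hhd x hx) (hfh.h_pos x hx).ne').hasDerivAt
  rw [(hqd.log hq.ne').deriv]
  exact div_ne_zero (hdec x hx).ne hq.ne'

theorem DensityPair.aemeasurable_score (hfh : DensityPair Ω f h)
    (hfd : ∀ x ∈ Ω, DifferentiableAt ℝ f x) (hhd : ∀ x ∈ Ω, DifferentiableAt ℝ h x) :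
    AEMeasurable (fun x => ENNReal.ofReal (f x ^ (θ - 1) * h x ^ (-θ) *
      |deriv (fun t => Real.log (f t / h t)) x|)) (volume.restrict Ω) := by
  have hm := hfh.isOpen.measurableSet
  have h1 : ContinuousOn (fun x => f x ^ (θ - 1) * h x ^ (-θ)) Ω := fun x hx =>
    (((hfd x hx).continuousAt.rpow_const (Or.inl (hfh.f_pos x hx).ne')).mul
      ((hhd x hx).continuousAt.rpow_const (Or.inl (hfh.h_pos x hx).ne'))).continuousWithinAt
  exact ENNReal.measurable_ofReal.comp_aemeasurable ((h1.aemeasurable hm).mul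
    (by simpa only [Real.norm_eq_abs] using (measurable_deriv (𝕜 := ℝ)
      (fun t => Real.log (f t / h t))).norm.aemeasurable))

/-- The integrand is strictly positive on a nonempty open set, because f/h has nonvanishing
derivative. Hence in the quotients below only the value ∞ can degenerate. -/
theorem DensityPair.relFisherIntegral_ne_zero (hfh : DensityPair Ω f h)
    (hfd : ∀ x ∈ Ω, DifferentiableAt ℝ f x) (hhd : ∀ x ∈ Ω, DifferentiableAt ℝ h x)
    (hdec : ∀ x ∈ Ω, deriv (fun t => f t / h t) x < 0) (p : ℝ) :
    relFisherIntegral p θ Ω f h ≠ 0 := by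
  have hm := hfh.isOpen.measurableSet
  have hd := fun x hx => hfh.deriv_log_div_ne_zero hfd hhd hdec (x := x) hx
  rw [relFisherIntegral_eq_lintegral hm hfh.f_pos hfh.h_pos hd p]
  have hmeas : AEMeasurable (fun x => ENNReal.ofReal (f x) *
      ENNReal.ofReal (f x ^ (θ - 1) * h x ^ (-θ) *
        |deriv (fun t => Real.log (f t / h t)) x|) ^ p) (volume.restrict Ω) :=
    (ENNReal.measurable_ofReal.comp_aemeasurable
      hfh.f_integrableOn.aestronglyMeasurable.aemeasurable).mul
      ((hfh.aemeasurable_score hfd hhd).pow_const p)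
  rw [Ne, lintegral_eq_zero_iff' hmeas, Filter.EventuallyEq, ae_restrict_iff' hm]
  intro h0
  have hpos := hfh.isOpen.measure_pos volume hfh.nonempty
  refine hpos.ne' (measure_mono_null ?_ h0)
  intro x hx h1
  have hfx := hfh.f_pos x hx
  have hhx := hfh.h_pos x hx
  have hdx := abs_pos.2 (hd x hx)
  have h2 := h1 hx
  rw [ENNReal.ofReal_rpow_of_pos (by positivity), ← ENNReal.ofReal_mul hfx.le] at h2
  have h3 : 0 < f x * (f x ^ (θ - 1) * h x ^ (-θ) *
      |deriv (fun t => Real.log (f t / h t)) x|) ^ p := by positivity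
  exact (ENNReal.ofReal_pos.2 h3).ne' h2

theorem DensityPair.relFisherIntegral_zero (hfh : DensityPair Ω f h)
    (hfd : ∀ x ∈ Ω, DifferentiableAt ℝ f x) (hhd : ∀ x ∈ Ω, DifferentiableAt ℝ h x)
    (hdec : ∀ x ∈ Ω, deriv (fun t => f t / h t) x < 0) :
    relFisherIntegral 0 θ Ω f h = 1 := by
  have hm := hfh.isOpen.measurableSet
  have hd := fun x hx => hfh.deriv_log_div_ne_zero hfd hhd hdec (x := x) hx
  rw [relFisherIntegral_eq_lintegral hm hfh.f_pos hfh.h_pos hd 0]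
  simp only [ENNReal.rpow_zero, mul_one]
  rw [← ofReal_integral_eq_lintegral_ofReal hfh.f_integrableOn
    ((ae_restrict_iff' hm).2 (Filter.Eventually.of_forall fun x hx => (hfh.f_pos x hx).le)),
    hfh.f_integral, ENNReal.ofReal_one]

theorem DensityPair.relFisherIntegral_convex_comb (hfh : DensityPair Ω f h)
    (hfd : ∀ x ∈ Ω, DifferentiableAt ℝ f x) (hhd : ∀ x ∈ Ω, DifferentiableAt ℝ h x)
    (hdec : ∀ x ∈ Ω, deriv (fun t => f t / h t) x < 0)
    (p₁ p₂ : ℝ) {a b : ℝ} (ha : 0 ≤ a) (hb : 0 ≤ b)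
    (hab : a + b = 1) :
    relFisherIntegral (a * p₁ + b * p₂) θ Ω f h ≤
      relFisherIntegral p₁ θ Ω f h ^ a * relFisherIntegral p₂ θ Ω f h ^ b := by
  have hm := hfh.isOpen.measurableSet
  have hd := fun x hx => hfh.deriv_log_div_ne_zero hfd hhd hdec (x := x) hx
  simp only [relFisherIntegral_eq_lintegral hm hfh.f_pos hfh.h_pos hd]
  have hmeas : ∀ p : ℝ, AEMeasurable (fun x => ENNReal.ofReal (f x) *
      ENNReal.ofReal (f x ^ (θ - 1) * h x ^ (-θ) *
        |deriv (fun t => Real.log (f t / h t)) x|) ^ p) (volume.restrict Ω) := fun p =>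
    (ENNReal.measurable_ofReal.comp_aemeasurable
      hfh.f_integrableOn.aestronglyMeasurable.aemeasurable).mul
      ((hfh.aemeasurable_score hfd hhd).pow_const p)
  refine le_of_eq_of_le ?_ (ENNReal.lintegral_mul_norm_pow_le (hmeas p₁) (hmeas p₂) ha hb hab)
  refine setLIntegral_congr_fun hm fun x hx => ?_
  have hfx := hfh.f_pos x hx
  have hhx := hfh.h_pos x hx
  have hdx := abs_pos.2 (hd x hx)
  have hX : 0 < f x ^ (θ - 1) * h x ^ (-θ) * |deriv (fun t => Real.log (f t / h t)) x| := by
    positivity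
  generalize f x ^ (θ - 1) * h x ^ (-θ) * |deriv (fun t => Real.log (f t / h t)) x| = X at hX
  simp only [ENNReal.ofReal_rpow_of_pos hX]
  rw [← ENNReal.ofReal_mul hfx.le, ← ENNReal.ofReal_mul hfx.le, ← ENNReal.ofReal_mul hfx.le,
    ENNReal.ofReal_rpow_of_pos (by positivity), ENNReal.ofReal_rpow_of_pos (by positivity),
    ← ENNReal.ofReal_mul (by positivity)]
  congr 1
  obtain ⟨u, hu⟩ := exists_eq_exp hfx
  obtain ⟨v, hv⟩ := exists_eq_exp hX
  rw [hu, hv]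
  simp only [← Real.exp_mul, ← Real.exp_add]
  congr 1
  have : b = 1 - a := by linarith
  rw [this]
  ring

end RelFisher

/-! ### Quotients in [0,∞] and the secant inequality -/

section LogConvex

/-- The quotient `x / y` is not of the form `0/0` or `∞/∞`. -/
def QuotientDefined (x y : ℝ≥0∞) : Prop := ¬ (x = 0 ∧ y = 0) ∧ ¬ (x = ∞ ∧ y = ∞)

theorem ENNReal.rpow_eq_zero_or_top_iff_of_pos {x : ℝ≥0∞} {s : ℝ} (hs : 0 < s) :
    (x ^ s = 0 ↔ x = 0) ∧ (x ^ s = ∞ ↔ x = ∞) :=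
  ⟨ENNReal.rpow_eq_zero_iff_of_pos hs, ENNReal.rpow_eq_top_iff_of_pos hs⟩

theorem ENNReal.rpow_eq_zero_or_top_iff_of_neg {x : ℝ≥0∞} {s : ℝ} (hs : s < 0) :
    (x ^ s = 0 ↔ x = ∞) ∧ (x ^ s = ∞ ↔ x = 0) := by
  constructor
  · simp [ENNReal.rpow_eq_zero_iff, hs, hs.not_gt]
  · simp [ENNReal.rpow_eq_top_iff, hs, hs.not_gt]

theorem QuotientDefined.rpow_iff {x y : ℝ≥0∞} {s : ℝ} (hs : s ≠ 0) :
    QuotientDefined (x ^ s) (y ^ s) ↔ QuotientDefined x y := by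
  rcases hs.lt_or_gt with h | h
  · simp only [QuotientDefined, ENNReal.rpow_eq_zero_or_top_iff_of_neg h]
    exact and_comm
  · simp only [QuotientDefined, ENNReal.rpow_eq_zero_or_top_iff_of_pos h]

theorem QuotientDefined.mul_left_iff {x y c : ℝ≥0∞} (h0 : c ≠ 0) (ht : c ≠ ∞) :
    QuotientDefined (c * x) (c * y) ↔ QuotientDefined x y := by
  simp [QuotientDefined, ENNReal.mul_eq_top, h0, ht]

/-- Definedness matters for negative `s`: with the convention 0/0 = ∞/∞ = 0, the left side would be
∞ and the right side 0. -/
theorem QuotientDefined.div_rpow {x y : ℝ≥0∞} (H : QuotientDefined x y) (s : ℝ) :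
    (x / y) ^ s = x ^ s / y ^ s := by
  rcases le_or_gt 0 s with h | h
  · exact ENNReal.div_rpow_of_nonneg _ _ h
  · have h' : 0 < -s := neg_pos.2 h
    obtain ⟨t, rfl⟩ : ∃ t, s = -t := ⟨-s, (neg_neg s).symm⟩
    rw [neg_neg] at h'
    simp only [ENNReal.rpow_neg, ENNReal.div_rpow_of_nonneg _ _ h'.le]
    have H' := (QuotientDefined.rpow_iff h'.ne').2 H
    rw [ENNReal.inv_div, ENNReal.div_eq_inv_mul, ENNReal.div_eq_inv_mul, inv_inv, mul_comm]
    · exact or_iff_not_imp_left.2 fun hy hx => H'.2 ⟨hx, not_not.1 hy⟩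
    · exact or_iff_not_imp_left.2 fun hy hx => H'.1 ⟨hx, not_not.1 hy⟩

variable {I : ℝ → ℝ≥0∞}

/-- Monotonicity in `p` of the slope over `[δ p, p]` of the logarithm of a log-convex function. -/
theorem toReal_log_slope_le (h0 : ∀ p, I p ≠ 0)
    (hconv : ∀ p₁ p₂ a b : ℝ, 0 ≤ a → 0 ≤ b → a + b = 1 →
      I (a * p₁ + b * p₂) ≤ I p₁ ^ a * I p₂ ^ b) {lam β δ : ℝ} (hlam : lam ≠ 0) (hβ : β ≠ 0)
    (hβlam : β < lam) (hδ : 0 < δ) (hδ1 : δ < 1) (h1 : I lam ≠ ∞) (h2 : I β ≠ ∞)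
    (h3 : I (δ * lam) ≠ ∞) (h4 : I (δ * β) ≠ ∞) :
    Real.log (I (δ * lam)).toReal / lam - Real.log (I (δ * β)).toReal / β ≤
      Real.log (I lam).toReal / lam - Real.log (I β).toReal / β := by
  have hpos : ∀ p, I p ≠ ∞ → 0 < (I p).toReal := fun p hp => ENNReal.toReal_pos (h0 p) hp
  have key : ∀ p₁ p₂ a b : ℝ, I p₁ ≠ ∞ → I p₂ ≠ ∞ → 0 ≤ a → 0 ≤ b → a + b = 1 →
      I (a * p₁ + b * p₂) ≠ ∞ ∧ Real.log (I (a * p₁ + b * p₂)).toReal ≤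
        a * Real.log (I p₁).toReal + b * Real.log (I p₂).toReal := by
    intro p₁ p₂ a b hp₁ hp₂ ha hb hab
    have hle := hconv p₁ p₂ a b ha hb hab
    have htop : I p₁ ^ a * I p₂ ^ b ≠ ∞ := ENNReal.mul_ne_top
      (ENNReal.rpow_ne_top_of_nonneg ha hp₁) (ENNReal.rpow_ne_top_of_nonneg hb hp₂)
    have hne := ne_top_of_le_ne_top htop hle
    refine ⟨hne, ?_⟩
    have h5 := Real.log_le_log (hpos _ hne) (ENNReal.toReal_mono htop hle)
    rwa [ENNReal.toReal_mul, ← ENNReal.toReal_rpow, ← ENNReal.toReal_rpow,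
      Real.log_mul (Real.rpow_pos_of_pos (hpos _ hp₁) _).ne'
        (Real.rpow_pos_of_pos (hpos _ hp₂) _).ne',
      Real.log_rpow (hpos _ hp₁), Real.log_rpow (hpos _ hp₂)] at h5
  have hcx : ConvexOn ℝ {p | I p ≠ ∞} (fun p => Real.log (I p).toReal) :=
    ⟨fun p₁ hp₁ p₂ hp₂ a b ha hb hab => (key p₁ p₂ a b hp₁ hp₂ ha hb hab).1,
      fun p₁ hp₁ p₂ hp₂ a b ha hb hab => (key p₁ p₂ a b hp₁ hp₂ ha hb hab).2⟩
  have hδβ : δ * β < δ * lam := mul_lt_mul_of_pos_left hβlam hδ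
  -- For β < 0 compare the secants over {β, δβ}, {β, δλ}, {δλ, λ}; for β > 0 those over {δβ, β},
  -- {δβ, λ}, {δλ, λ}. Consecutive secants share an endpoint, so two monotonicity steps suffice.
  have hslope : (Real.log (I β).toReal - Real.log (I (δ * β)).toReal) / (β - δ * β) ≤
      (Real.log (I lam).toReal - Real.log (I (δ * lam)).toReal) / (lam - δ * lam) := by
    rcases hβ.lt_or_gt with hneg | hpos'
    · have hb : β < δ * β := by nlinarith
      have s1 := hcx.secant_mono h2 h4 h3 hb.ne' (hb.trans hδβ).ne' hδβ.le
      have hl : δ * lam ≠ lam := fun h => hlam (by nlinarith)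
      have s2 := hcx.secant_mono h3 h2 h1 (hb.trans hδβ).ne hl.symm hβlam.le
      calc _ = (Real.log (I (δ * β)).toReal - Real.log (I β).toReal) / (δ * β - β) := by
            rw [← neg_sub, ← neg_sub (δ * β) β, neg_div_neg_eq]
        _ ≤ _ := s1
        _ = (Real.log (I β).toReal - Real.log (I (δ * lam)).toReal) / (β - δ * lam) := by
            rw [← neg_sub, ← neg_sub β (δ * lam), neg_div_neg_eq]
        _ ≤ _ := s2
    · have hb : δ * β < β := by nlinarith
      have hl : δ * lam < lam := by nlinarith
      have s1 := hcx.secant_mono h4 h2 h1 hb.ne' (hb.trans hβlam).ne' hβlam.le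
      have s2 := hcx.secant_mono h1 h4 h3 (hb.trans hβlam).ne hl.ne hδβ.le
      calc _ ≤ _ := s1
        _ = (Real.log (I (δ * β)).toReal - Real.log (I lam).toReal) / (δ * β - lam) := by
            rw [← neg_sub, ← neg_sub (δ * β) lam, neg_div_neg_eq]
        _ ≤ _ := s2
        _ = _ := by rw [← neg_sub, ← neg_sub lam, neg_div_neg_eq]
  -- The common factor 1-δ of the two denominators is positive and drops out, leaving the division
  -- by `lam` and `β`.
  have e1 : ∀ p : ℝ, p - δ * p = p * (1 - δ) := fun p => by ring
  rw [e1, e1, ← div_div, ← div_div, div_le_div_iff_of_pos_right (by linarith), sub_div, sub_div]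
    at hslope
  linarith

/-- The set where `I` is finite is convex and contains 0, hence is stable under multiplication by δ
in (0,1). If both values of `I` in the given quotient are finite, the secant inequality decides;
otherwise definedness forces the larger quotient to be ∞. -/
theorem QuotientDefined.of_logConvex (h0 : ∀ p, I p ≠ 0) (hI0 : I 0 ≠ ∞)
    (hconv : ∀ p₁ p₂ a b : ℝ, 0 ≤ a → 0 ≤ b → a + b = 1 →
      I (a * p₁ + b * p₂) ≤ I p₁ ^ a * I p₂ ^ b) {lam β δ : ℝ} (hlam : lam ≠ 0) (hβ : β ≠ 0)
    (hβlam : β < lam) (hδ : 0 < δ) (hδ1 : δ < 1)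
    (H : QuotientDefined (I lam ^ (1 / lam)) (I β ^ (1 / β))) :
    QuotientDefined (I (δ * lam) ^ (1 / lam)) (I (δ * β) ^ (1 / β)) ∧
      I (δ * lam) ^ (1 / lam) / I (δ * β) ^ (1 / β) ≤ I lam ^ (1 / lam) / I β ^ (1 / β) := by
  have hfin : ∀ p₁ p₂ a : ℝ, I p₁ ≠ ∞ → I p₂ ≠ ∞ → 0 ≤ a → a ≤ 1 →
      I (a * p₁ + (1 - a) * p₂) ≠ ∞ := fun p₁ p₂ a h1 h2 ha ha1 =>
    ne_top_of_le_ne_top (ENNReal.mul_ne_top (ENNReal.rpow_ne_top_of_nonneg ha h1)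
      (ENNReal.rpow_ne_top_of_nonneg (sub_nonneg.2 ha1) h2))
      (hconv p₁ p₂ a (1 - a) ha (sub_nonneg.2 ha1) (by ring))
  have hscale : ∀ p t : ℝ, I p ≠ ∞ → 0 ≤ t → t ≤ 1 → I (t * p) ≠ ∞ := fun p t hp ht ht1 => by
    simpa using hfin p 0 t hp hI0 ht ht1
  have hposexp : ∀ p q : ℝ, 0 < p → (I q ^ (1 / p) = 0 ↔ I q = 0) ∧ (I q ^ (1 / p) = ∞ ↔ I q = ∞) :=
    fun p q hp => ENNReal.rpow_eq_zero_or_top_iff_of_pos (one_div_pos.2 hp)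
  have hnegexp : ∀ p q : ℝ, p < 0 → (I q ^ (1 / p) = 0 ↔ I q = ∞) ∧ (I q ^ (1 / p) = ∞ ↔ I q = 0) :=
    fun p q hp => ENNReal.rpow_eq_zero_or_top_iff_of_neg (one_div_neg.2 hp)
  have hmain : QuotientDefined (I (δ * lam) ^ (1 / lam)) (I (δ * β) ^ (1 / β)) ∧
      ((I lam ≠ ∞ ∧ I β ≠ ∞) ∨ I lam ^ (1 / lam) / I β ^ (1 / β) = ∞) := by
    rcases hβ.lt_or_gt with hb | hb <;> rcases hlam.lt_or_gt with hl | hl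
    · have h1 : I lam ≠ ∞ := fun h => by
        have : I β ≠ ∞ := fun h' => H.1 ⟨(hnegexp lam lam hl).1.2 h, (hnegexp β β hb).1.2 h'⟩
        -- Here `lam` lies between `β` and 0, so finiteness at `β` passes to `lam`.
        have h2 := hscale β (lam / β) this (div_nonneg_of_nonpos hl.le hb.le)
          ((div_le_one_of_neg hb).2 hβlam.le)
        rw [div_mul_cancel₀ _ hβ] at h2
        exact h2 h
      refine ⟨⟨fun h => hscale lam δ h1 hδ.le hδ1.le ((hnegexp lam (δ * lam) hl).1.1 h.1), fun h =>
        h0 _ ((hnegexp lam (δ * lam) hl).2.1 h.1)⟩, ?_⟩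
      by_cases h2 : I β = ∞
      · right
        rw [(hnegexp β β hb).1.2 h2, ENNReal.div_zero]
        exact fun h => h1 ((hnegexp lam lam hl).1.1 h)
      · exact Or.inl ⟨h1, h2⟩
    -- With opposite signs the numerator is never 0 and the denominator never ∞, so the quotient is
    -- always defined.
    · refine ⟨⟨fun h => h0 _ ((hposexp lam (δ * lam) hl).1.1 h.1),
        fun h => h0 _ ((hnegexp β (δ * β) hb).2.1 h.2)⟩, ?_⟩
      by_cases h2 : I β = ∞
      · right
        rw [(hnegexp β β hb).1.2 h2, ENNReal.div_zero]
        exact fun h => h0 _ ((hposexp lam lam hl).1.1 h)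
      · by_cases h1 : I lam = ∞
        · right
          rw [(hposexp lam lam hl).2.2 h1, ENNReal.top_div_of_ne_top]
          exact fun h => h0 _ ((hnegexp β β hb).2.1 h)
        · exact Or.inl ⟨h1, h2⟩
    · linarith
    · have h2 : I β ≠ ∞ := fun h => by
        have : I lam ≠ ∞ := fun h' => H.2 ⟨(hposexp lam lam hl).2.2 h', (hposexp β β hb).2.2 h⟩
        have h2 := hscale lam (β / lam) this (div_nonneg hb.le hl.le)
          ((div_le_one hl).2 hβlam.le)
        rw [div_mul_cancel₀ _ hlam] at h2
        exact h2 h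
      refine ⟨⟨fun h => h0 _ ((hposexp β (δ * β) hb).1.1 h.2), fun h =>
        hscale β δ h2 hδ.le hδ1.le ((hposexp β (δ * β) hb).2.1 h.2)⟩, ?_⟩
      by_cases h1 : I lam = ∞
      · right
        rw [(hposexp lam lam hl).2.2 h1, ENNReal.top_div_of_ne_top]
        exact fun h => h2 ((hposexp β β hb).2.1 h)
      · exact Or.inl ⟨h1, h2⟩
  refine ⟨hmain.1, ?_⟩
  rcases hmain.2 with ⟨h1, h2⟩ | htop
  · have h3 := hscale lam δ h1 hδ.le hδ1.le
    have h4 := hscale β δ h2 hδ.le hδ1.le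
    have hlog := toReal_log_slope_le h0 hconv hlam hβ hβlam hδ hδ1 h1 h2 h3 h4
    have e : ∀ q p : ℝ, I q ≠ ∞ → I q ^ (1 / p) =
        ENNReal.ofReal (Real.exp (Real.log (I q).toReal / p)) := fun q p hq => by
      have hp := ENNReal.toReal_pos (h0 q) hq
      conv_lhs => rw [← ENNReal.ofReal_toReal hq]
      rw [ENNReal.ofReal_rpow_of_pos hp, Real.rpow_def_of_pos hp, mul_one_div]
    rw [e _ _ h1, e _ _ h2, e _ _ h3, e _ _ h4, ← ENNReal.ofReal_div_of_pos (Real.exp_pos _),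
      ← ENNReal.ofReal_div_of_pos (Real.exp_pos _), ← Real.exp_sub, ← Real.exp_sub]
    exact ENNReal.ofReal_le_ofReal (Real.exp_le_exp.2 hlog)
  · rw [htop]
    exact le_top

end LogConvex

/-! ### Existence of a version for δ in (0,1) -/

/-- The primitive of a positive integrable weight vanishing at the left end maps the interval onto
`(0, ∫ w)`. -/
theorem image_setIntegral_Iio {w : ℝ → ℝ} {Ω : Set ℝ} (hΩ : IsOpen Ω) (hc : Ω.OrdConnected)
    (hw : ∀ x ∈ Ω, 0 < w x) (hint : IntegrableOn w Ω) :
    StrictPrimitiveOn w (fun x => ∫ t in Ω ∩ Iio x, w t) Ω ∧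
      (fun x => ∫ t in Ω ∩ Iio x, w t) '' Ω = Ioo 0 (∫ t in Ω, w t) := by
  have hφ : StrictPrimitiveOn w (fun x => ∫ t in Ω ∩ Iio x, w t) Ω :=
    ⟨hΩ, hc, isPrimitiveOn_setIntegral_Iio hc fun x _ => hint.mono_set inter_subset_left,
      Or.inl hw⟩
  refine ⟨hφ, ?_⟩
  have hnn : 0 ≤ᵐ[volume.restrict Ω] w := (ae_restrict_iff' hΩ.measurableSet).2
    (Filter.Eventually.of_forall fun x hx => (hw x hx).le)
  have hsub : (fun x => ∫ t in Ω ∩ Iio x, w t) '' Ω ⊆ Ioo 0 (∫ t in Ω, w t) := by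
    rintro _ ⟨x, hx, rfl⟩
    obtain ⟨a, b, hax, hxb, hab⟩ := StrictPrimitiveOn.exists_Icc_mem_nhds hΩ hx
    have h1 : ∀ y ∈ Ω, 0 ≤ ∫ t in Ω ∩ Iio y, w t := fun y _ =>
      setIntegral_nonneg (hΩ.measurableSet.inter measurableSet_Iio) fun t ht => (hw t ht.1).le
    have h2 : ∀ y ∈ Ω, ∫ t in Ω ∩ Iio y, w t ≤ ∫ t in Ω, w t := fun y _ =>
      setIntegral_mono_set hint hnn (Filter.Eventually.of_forall inter_subset_left)
    have ha : a ∈ Ω := hab ⟨le_rfl, by linarith⟩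
    have hb : b ∈ Ω := hab ⟨by linarith, le_rfl⟩
    have hm := hφ.strictMonoOn hw
    exact ⟨(h1 a ha).trans_lt (hm ha hx hax), (hm hx hb hxb).trans_le (h2 b hb)⟩
  refine hsub.antisymm fun t ht => ?_
  by_contra hn
  have hvol : volume ((fun x => ∫ t in Ω ∩ Iio x, w t) '' Ω) =
      ENNReal.ofReal (∫ t in Ω, w t) := by
    have h1 := hφ.lintegral_image (fun _ => 1)
    rw [setLIntegral_one] at h1
    rw [h1, ofReal_integral_eq_lintegral_ofReal hint hnn]
    refine setLIntegral_congr_fun hΩ.measurableSet fun x hx => ?_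
    simp only [mul_one, abs_of_pos (hw x hx)]
  -- The image is an interval, so missing `t` confines it to one side; its length, already known to
  -- be all of ∫ w, would then be too small.
  have hsplit : (fun x => ∫ t in Ω ∩ Iio x, w t) '' Ω ⊆ Ioo 0 t ∨
      (fun x => ∫ t in Ω ∩ Iio x, w t) '' Ω ⊆ Ioo t (∫ t in Ω, w t) := by
    by_cases h : ∃ a ∈ (fun x => ∫ t in Ω ∩ Iio x, w t) '' Ω, t < a
    · obtain ⟨a, ha, hta⟩ := h
      refine Or.inr fun b hb => ⟨?_, (hsub hb).2⟩
      by_contra hbt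
      exact hn (hφ.image_ordConnected.out hb ha ⟨not_lt.1 hbt, hta.le⟩)
    · refine Or.inl fun b hb => ⟨(hsub hb).1, lt_of_le_of_ne (not_lt.1 fun hb' => h ⟨b, hb, hb'⟩) ?_⟩
      rintro rfl
      exact hn hb
  rcases hsplit with h | h <;>
  · have h1 := measure_mono (μ := volume) h
    rw [hvol, Real.volume_Ioo, ENNReal.ofReal_le_ofReal_iff (by linarith [ht.1, ht.2])] at h1
    linarith [ht.1, ht.2]

/-- With z = r y and r = I^α, where I = ∫ g^((α-1)/α), the equation separates: g(z)^((α-1)/α) z' = I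
h. So z = G⁻¹(I H) for the primitives G and H vanishing at the left ends. Both sides have total mass
I because ∫ h = 1, which makes `z` onto. -/
theorem exists_isRelEscortInv {α : ℝ} {h g : ℝ → ℝ} {Ω Ω' : Set ℝ} (hα : 0 < α)
    (hΩ : IsOpen Ω) (hc : Ω.OrdConnected) (hh : ∀ x ∈ Ω, 0 < h x) (hhint : IntegrableOn h Ω)
    (hh1 : ∫ x in Ω, h x = 1) (hΩ' : IsOpen Ω') (hc' : Ω'.OrdConnected) (hne' : Ω'.Nonempty)
    (hg : ∀ x ∈ Ω', 0 < g x) (hgint : IntegrableOn (fun x => g x ^ ((α - 1) / α)) Ω') :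
    ∃ F, IsRelEscortInv α h Ω' g Ω F := by
  have hgpos : ∀ x ∈ Ω', 0 < g x ^ ((α - 1) / α) := fun x hx => Real.rpow_pos_of_pos (hg x hx) _
  obtain ⟨hG, hGimg⟩ := image_setIntegral_Iio hΩ' hc' hgpos hgint
  obtain ⟨hH, hHimg⟩ := image_setIntegral_Iio hΩ hc hh hhint
  set I := ∫ x in Ω', g x ^ ((α - 1) / α) with hI
  have hI0 : 0 < I := setIntegral_pos hΩ' hne' hgpos hgint
  rw [hh1] at hHimg
  have hξ : 1 / (1 - (α - 1) / α) = α := by field_simp; ring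
  have hN : renyiPower ((α - 1) / α) Ω' g = ENNReal.ofReal (I ^ α) := by
    rw [renyiPower, hξ, ← ENNReal.ofReal_rpow_of_pos hI0, hI,
      ofReal_integral_eq_lintegral_ofReal hgint ((ae_restrict_iff' hΩ'.measurableSet).2
        (Filter.Eventually.of_forall fun x hx => (hgpos x hx).le))]
    congr 1
    exact setLIntegral_congr_fun hΩ'.measurableSet fun x hx =>
      ENNReal.ofReal_rpow_of_pos (hg x hx)
  have hIH : StrictPrimitiveOn (fun x => I * h x) (fun x => I * ∫ t in Ω ∩ Iio x, h t) Ω :=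
    ⟨hΩ, hc, hH.prim.const_mul I, Or.inl fun x hx => mul_pos hI0 (hh x hx)⟩
  have hIHimg : (fun x => I * ∫ t in Ω ∩ Iio x, h t) '' Ω = Ioo 0 I := by
    rw [← image_image (fun t => I * t) (fun x => ∫ t in Ω ∩ Iio x, h t), hHimg,
      image_mul_left_Ioo hI0, mul_zero, mul_one]
  set G : ℝ → ℝ := fun x => ∫ t in Ω' ∩ Iio x, g t ^ ((α - 1) / α) with hGdef
  have hχ : ∀ x ∈ Ω', Function.invFunOn G Ω' (G x) = x := fun x hx =>
    hG.injOn.leftInvOn_invFunOn hx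
  have hinv := hG.inverse hχ
  rw [hGimg, ← hIHimg] at hinv
  have hz := hIH.comp hinv
  set z : ℝ → ℝ := fun x => Function.invFunOn G Ω' (I * ∫ t in Ω ∩ Iio x, h t) with hzdef
  have hzimg : z '' Ω = Ω' := by
    rw [hzdef, ← image_image (Function.invFunOn G Ω') (fun x => I * ∫ t in Ω ∩ Iio x, h t), hIHimg,
      ← hGimg]
    exact hG.injOn.leftInvOn_invFunOn.image_image
  have hr : 0 < I ^ α := Real.rpow_pos_of_pos hI0 _
  have hrz : ∀ x, I ^ α * ((I ^ α)⁻¹ * z x) = z x := fun x => mul_inv_cancel_left₀ hr.ne' _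
  refine ⟨fun x => (I ^ α * g (z x)) ^ (1 / α) * h x, hN ▸ ENNReal.ofReal_lt_top, I ^ α,
    by rw [hN, ENNReal.toReal_ofReal hr.le], fun x => (I ^ α)⁻¹ * z x, ?_, ?_, ?_⟩
  · refine (hz.prim.const_mul (I ^ α)⁻¹).congr hc (fun x hx => ?_) fun x _ => rfl
    have hgz : 0 < g (z x) := hg _ (hzimg ▸ mem_image_of_mem z hx)
    simp only [hrz]
    change (I ^ α)⁻¹ * (I * h x * (g (z x) ^ ((α - 1) / α))⁻¹) = _
    rw [← mul_assoc, ← mul_assoc, mul_right_comm]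
    congr 1
    obtain ⟨a, ha⟩ := exists_eq_exp hgz
    obtain ⟨b, hb⟩ := exists_eq_exp hI0
    rw [ha, hb]
    simp only [← Real.exp_mul, ← Real.exp_add, ← Real.exp_neg]
    congr 1
    field_simp
    ring
  · simp only [hrz]
    exact hzimg
  · intro x _
    simp only [hrz]

/-- Weighted AM-GM dominates the product by δh + (1-δ)f. -/
theorem integrableOn_rpow_mul_rpow {f h : ℝ → ℝ} {Ω : Set ℝ} (hΩ : MeasurableSet Ω) {δ : ℝ}
    (hδ : 0 ≤ δ) (hδ1 : δ ≤ 1) (hh : ∀ x ∈ Ω, 0 < h x) (hhint : IntegrableOn h Ω)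
    (hf : ∀ x ∈ Ω, 0 < f x) (hfint : IntegrableOn f Ω) :
    IntegrableOn (fun t => h t ^ δ * f t ^ (1 - δ)) Ω := by
  refine ((hhint.const_mul δ).add (hfint.const_mul (1 - δ))).mono' ?_ ?_
  · exact ((hhint.aestronglyMeasurable.aemeasurable.pow_const δ).mul
      (hfint.aestronglyMeasurable.aemeasurable.pow_const (1 - δ))).aestronglyMeasurable
  · refine (ae_restrict_iff' hΩ).2 (Filter.Eventually.of_forall fun x hx => ?_)
    have h1 := hh x hx
    have h2 := hf x hx
    rw [Real.norm_of_nonneg (by positivity)]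
    exact Real.geom_mean_le_arith_mean2_weighted hδ (sub_nonneg.2 hδ1) h1.le h2.le (by ring)

/-- The normalised primitives H and K⁻¹P both map `Ω` onto (0,1), so H⁻¹ ∘ K⁻¹P is the required
bijection. -/
theorem exists_isDivergenceTransform {δ : ℝ} {h F : ℝ → ℝ} {Ω : Set ℝ} (hδ : 0 < δ) (hδ1 : δ < 1)
    (hΩ : IsOpen Ω) (hc : Ω.OrdConnected) (hne : Ω.Nonempty)
    (hh : ∀ x ∈ Ω, 0 < h x) (hhint : IntegrableOn h Ω) (hh1 : ∫ x in Ω, h x = 1)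
    (hF : ∀ x ∈ Ω, 0 < F x) (hFint : IntegrableOn F Ω) :
    ∃ F', IsDivergenceTransform δ h Ω F F' := by
  have hint := integrableOn_rpow_mul_rpow hΩ.measurableSet hδ.le hδ1.le hh hhint hF hFint
  have hpos : ∀ x ∈ Ω, 0 < h x ^ δ * F x ^ (1 - δ) := fun x hx =>
    mul_pos (Real.rpow_pos_of_pos (hh x hx) _) (Real.rpow_pos_of_pos (hF x hx) _)
  obtain ⟨hP, hPimg⟩ := image_setIntegral_Iio hΩ hc hpos hint
  obtain ⟨hH, hHimg⟩ := image_setIntegral_Iio hΩ hc hh hhint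
  set K := ∫ t in Ω, h t ^ δ * F t ^ (1 - δ) with hK
  have hK0 : 0 < K := setIntegral_pos hΩ hne hpos hint
  rw [hh1] at hHimg
  set P : ℝ → ℝ := fun x => ∫ t in Ω ∩ Iio x, h t ^ δ * F t ^ (1 - δ)
  set H : ℝ → ℝ := fun x => ∫ t in Ω ∩ Iio x, h t
  have hKP : (fun x => K⁻¹ * P x) '' Ω = H '' Ω := by
    rw [← image_image (fun t => K⁻¹ * t) P, hPimg, image_mul_left_Ioo (inv_pos.2 hK0), mul_zero,
      inv_mul_cancel₀ hK0.ne', hHimg]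
  set y : ℝ → ℝ := fun x => Function.invFunOn H Ω (K⁻¹ * P x) with hy
  have hmem : ∀ x ∈ Ω, K⁻¹ * P x ∈ H '' Ω := fun x hx =>
    hKP ▸ mem_image_of_mem (fun x => K⁻¹ * P x) hx
  have hyH : ∀ x ∈ Ω, H (y x) = K⁻¹ * P x := fun x hx => Function.invFunOn_eq (hmem x hx)
  have hyinj : InjOn y Ω := fun a ha b hb hab => by
    have h1 := hyH a ha
    rw [hab, hyH b hb] at h1
    exact (hP.injOn ha hb (mul_left_cancel₀ (inv_pos.2 hK0).ne' h1.symm))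
  refine ⟨fun v => K * (F (Function.invFunOn y Ω v) / h (Function.invFunOn y Ω v)) ^ δ * h v,
    hint, K, hK, y, ⟨fun x hx => Function.invFunOn_mem (hmem x hx), hyinj, fun v hv => ?_⟩, hyH,
    fun x hx => ?_⟩
  · obtain ⟨x, hx, hxv⟩ : H v ∈ (fun x => K⁻¹ * P x) '' Ω := hKP ▸ mem_image_of_mem H hv
    refine ⟨x, hx, hH.injOn (Function.invFunOn_mem (hmem x hx)) hv ?_⟩
    rw [hyH x hx]
    exact hxv
  · simp only [hyinj.leftInvOn_invFunOn hx]

theorem exists_isRelEscort_of_isPrimitiveOn {α : ℝ} {h f y : ℝ → ℝ} {Ω : Set ℝ} (hΩ : IsOpen Ω)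
    (hc : Ω.OrdConnected) (hf : ∀ x ∈ Ω, 0 < f x) (hh : ∀ x ∈ Ω, 0 < h x)
    (hy : IsPrimitiveOn (fun x => f x ^ (1 - α) * h x ^ α) y Ω) :
    IsRelEscort α h Ω f (y '' Ω) (fun t =>
      (f (Function.invFunOn y Ω t) / h (Function.invFunOn y Ω t)) ^ α) :=
  ⟨y, hy, rfl, fun x hx => by
    simp only [(strictPrimitiveOn_relEscort hΩ hc hf hh hy).injOn.leftInvOn_invFunOn hx]⟩

theorem isPrimitiveOn_intervalIntegral {w : ℝ → ℝ} {Ω : Set ℝ} {c : ℝ} (hc : c ∈ Ω)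
    (hw : ∀ a ∈ Ω, ∀ b ∈ Ω, IntervalIntegrable w volume a b) :
    IsPrimitiveOn w (fun x => ∫ t in c..x, w t) Ω := fun a ha b hb =>
  ⟨hw a ha b hb, (intervalIntegral.integral_interval_sub_left (hw c hc b hb) (hw c hc a ha)).symm⟩

/-- A differentiable function with derivative of constant sign is a primitive of it. -/
theorem isPrimitiveOn_of_hasDerivAt_nonneg {w φ : ℝ → ℝ} {Ω : Set ℝ} (hc : Ω.OrdConnected)
    (hφ : ∀ x ∈ Ω, HasDerivAt φ (w x) x) (hw : ∀ x ∈ Ω, 0 ≤ w x) : IsPrimitiveOn w φ Ω := by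
  refine IsPrimitiveOn.of_le fun a ha b hb hab => ?_
  have hsub : Icc a b ⊆ Ω := hc.out ha hb
  have h1 : IntervalIntegrable w volume a b := by
    rw [intervalIntegrable_iff_integrableOn_Ioc_of_le hab]
    exact intervalIntegral.integrableOn_deriv_of_nonneg
      (fun x hx => (hφ x (hsub hx)).continuousAt.continuousWithinAt)
      (fun x hx => hφ x (hsub (Ioo_subset_Icc_self hx)))
      (fun x hx => hw x (hsub (Ioo_subset_Icc_self hx)))
  refine ⟨h1, intervalIntegral.integral_eq_sub_of_hasDerivAt (fun x hx => hφ x (hsub ?_)) h1⟩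
  rwa [uIcc_of_le hab] at hx

/-- The additive constant of the down variable is fixed by taking s = g₁^(2-γ)/(γ-2). This puts the
support on the negative axis for γ < 2 and on the positive axis for γ > 2, and gives `s` explicitly
in terms of f/h. -/
theorem exists_isRelEscort_isDown {α γ : ℝ} {h f : ℝ → ℝ} {Ω : Set ℝ} (hα : 0 < α) (hγ : γ ≠ 2)
    (hfh : DensityPair Ω f h)
    (hfd : ∀ x ∈ Ω, DifferentiableAt ℝ f x) (hhd : ∀ x ∈ Ω, DifferentiableAt ℝ h x)
    (hdec : ∀ x ∈ Ω, deriv (fun t => f t / h t) x < 0) :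
    ∃ (y s g₁ g₂ : ℝ → ℝ),
      StrictPrimitiveOn (fun x => f x ^ (1 - α) * h x ^ α) y Ω ∧
      (∀ x ∈ Ω, g₁ (y x) = (f x / h x) ^ α) ∧
      StrictPrimitiveOn (fun x => g₁ x ^ (1 - γ) * |deriv g₁ x|) s (y '' Ω) ∧
      (∀ x ∈ y '' Ω, s x = g₁ x ^ (2 - γ) / (γ - 2)) ∧
      (∀ x ∈ y '' Ω, g₂ (s x) = g₁ x ^ γ * |deriv g₁ x|⁻¹) ∧
      IsRelEscort α h Ω f (y '' Ω) g₁ ∧ IsDown γ (y '' Ω) g₁ (s '' (y '' Ω)) g₂ := by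
  have hΩ := hfh.isOpen
  have hc := hfh.ordConnected
  obtain ⟨x₀, hx₀⟩ := hfh.nonempty
  have hwc : ContinuousOn (fun x => f x ^ (1 - α) * h x ^ α) Ω := fun x hx =>
    (((hfd x hx).continuousAt.rpow_const (Or.inl (hfh.f_pos x hx).ne')).mul
      ((hhd x hx).continuousAt.rpow_const (Or.inl (hfh.h_pos x hx).ne'))).continuousWithinAt
  set y : ℝ → ℝ := fun x => ∫ t in x₀..x, f t ^ (1 - α) * h t ^ α
  have hyp : IsPrimitiveOn (fun x => f x ^ (1 - α) * h x ^ α) y Ω :=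
    isPrimitiveOn_intervalIntegral hx₀ fun a ha b hb =>
      (hwc.mono (hc.uIcc_subset ha hb)).intervalIntegrable
  have hy := strictPrimitiveOn_relEscort hΩ hc hfh.f_pos hfh.h_pos hyp
  have hE := exists_isRelEscort_of_isPrimitiveOn hΩ hc hfh.f_pos hfh.h_pos hyp
  set χ := Function.invFunOn y Ω
  have hχ : ∀ x ∈ Ω, χ (y x) = x := fun x hx => hy.injOn.leftInvOn_invFunOn hx
  have hχp := hy.inverse hχ
  set g₁ : ℝ → ℝ := fun t => (f (χ t) / h (χ t)) ^ α with hg₁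
  have hg₁y : ∀ x ∈ Ω, g₁ (y x) = (f x / h x) ^ α := fun x hx => by simp only [hg₁, hχ x hx]
  have hχmem : ∀ t ∈ y '' Ω, χ t ∈ Ω := by
    rintro _ ⟨x, hx, rfl⟩
    rwa [hχ x hx]
  have hwχ : ContinuousOn (fun t => (f (χ t) ^ (1 - α) * h (χ t) ^ α)⁻¹) (y '' Ω) := by
    refine ContinuousOn.inv₀ (hwc.comp hχp.continuousOn hχmem) fun t ht => ?_
    exact hy.ne_zero (hχmem t ht)
  have hg₁d : ∀ t ∈ y '' Ω, ∃ d < 0, HasDerivAt g₁ d t := by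
    intro t ht
    have hx := hχmem t ht
    have hq : 0 < f (χ t) / h (χ t) := div_pos (hfh.f_pos _ hx) (hfh.h_pos _ hx)
    have hqd : HasDerivAt (fun t => f t / h t) (deriv (fun t => f t / h t) (χ t)) (χ t) :=
      ((hfd _ hx).div (hhd _ hx) (hfh.h_pos _ hx).ne').hasDerivAt
    have h1 := hχp.hasDerivAt ht hwχ
    have h2 := (hqd.rpow_const (p := α) (Or.inl hq.ne')).comp t h1
    refine ⟨_, ?_, h2⟩
    refine mul_neg_of_neg_of_pos (mul_neg_of_neg_of_pos (mul_neg_of_neg_of_pos (hdec _ hx) hα)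
      (Real.rpow_pos_of_pos hq _)) (inv_pos.2 (mul_pos (Real.rpow_pos_of_pos (hfh.f_pos _ hx) _)
        (Real.rpow_pos_of_pos (hfh.h_pos _ hx) _)))
  have hdiff : ∀ t ∈ y '' Ω, DifferentiableAt ℝ g₁ t ∧ deriv g₁ t < 0 := fun t ht => by
    obtain ⟨d, hd, hd'⟩ := hg₁d t ht
    exact ⟨hd'.differentiableAt, hd'.deriv.symm ▸ hd⟩
  have hg₁pos : ∀ t ∈ y '' Ω, 0 < g₁ t := fun t ht => Real.rpow_pos_of_pos
    (div_pos (hfh.f_pos _ (hχmem t ht)) (hfh.h_pos _ (hχmem t ht))) _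
  have hγ' : γ - 2 ≠ 0 := sub_ne_zero.2 hγ
  have hwpos : ∀ t ∈ y '' Ω, 0 < g₁ t ^ (1 - γ) * |deriv g₁ t| := fun t ht =>
    mul_pos (Real.rpow_pos_of_pos (hg₁pos t ht) _) (abs_pos.2 (hdiff t ht).2.ne)
  have hs : StrictPrimitiveOn (fun x => g₁ x ^ (1 - γ) * |deriv g₁ x|)
      (fun x => g₁ x ^ (2 - γ) / (γ - 2)) (y '' Ω) := by
    -- The derivative of `g₁` need not be continuous; its constant sign supplies local
    -- integrability.
    refine ⟨hy.image_isOpen, hy.image_ordConnected, isPrimitiveOn_of_hasDerivAt_nonneg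
      hy.image_ordConnected (fun t ht => ?_) fun t ht => (hwpos t ht).le, Or.inl hwpos⟩
    have h1 := ((hdiff t ht).1.hasDerivAt.rpow_const (p := 2 - γ)
      (Or.inl (hg₁pos t ht).ne')).div_const (γ - 2)
    refine h1.congr_deriv ?_
    rw [abs_of_neg (hdiff t ht).2, show 2 - γ - 1 = 1 - γ by ring]
    field_simp
    ring
  refine ⟨y, fun x => g₁ x ^ (2 - γ) / (γ - 2), g₁, fun t =>
    g₁ (Function.invFunOn (fun x => g₁ x ^ (2 - γ) / (γ - 2)) (y '' Ω) t) ^ γ *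
    |deriv g₁ (Function.invFunOn (fun x => g₁ x ^ (2 - γ) / (γ - 2)) (y '' Ω) t)|⁻¹, hy, hg₁y, hs,
    fun _ _ => rfl, ?_, hE, hdiff, _, hs.prim, rfl, ?_⟩ <;>
  · intro x hx
    simp only [hs.injOn.leftInvOn_invFunOn hx]

theorem integrableOn_rpow_of_volume_ne_top {g : ℝ → ℝ} {S : Set ℝ} (hS : MeasurableSet S)
    (hvol : volume S ≠ ∞) {δ : ℝ} (hδ : 0 ≤ δ) (hδ1 : δ ≤ 1) (hg : ∀ x ∈ S, 0 < g x)
    (hint : IntegrableOn g S) : IntegrableOn (fun t => g t ^ (1 - δ)) S := by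
  simpa using integrableOn_rpow_mul_rpow hS hδ hδ1 (h := fun _ => 1) (fun _ _ => one_pos)
    (integrableOn_const hvol) hg hint

/-- Hölder against the constant function 1. -/
theorem setIntegral_rpow_le {g : ℝ → ℝ} {S : Set ℝ} (hS : MeasurableSet S) {v : ℝ} (hv : 0 < v)
    (hvol : volume S ≤ ENNReal.ofReal v) {δ : ℝ} (hδ : 0 ≤ δ) (hδ1 : δ ≤ 1)
    (hg : ∀ x ∈ S, 0 < g x) (hint : IntegrableOn g S) :
    ∫ t in S, g t ^ (1 - δ) ≤ (∫ t in S, g t) ^ (1 - δ) * v ^ δ := by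
  have hnn : 0 ≤ ∫ t in S, g t := setIntegral_nonneg hS fun t ht => (hg t ht).le
  have h1 := ENNReal.lintegral_mul_norm_pow_le (μ := volume.restrict S) (f := fun t =>
    ENNReal.ofReal (g t)) (g := fun _ => 1) hint.aestronglyMeasurable.aemeasurable.ennreal_ofReal
    aemeasurable_const (sub_nonneg.2 hδ1) hδ (by ring)
  simp only [ENNReal.one_rpow, mul_one, lintegral_const, Measure.restrict_apply_univ, one_mul] at h1
  have h2 : ∫⁻ t in S, ENNReal.ofReal (g t) ^ (1 - δ) = ENNReal.ofReal (∫ t in S, g t ^ (1 - δ)) := by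
    rw [ofReal_integral_eq_lintegral_ofReal (integrableOn_rpow_of_volume_ne_top hS
      (ne_top_of_le_ne_top ENNReal.ofReal_ne_top hvol) hδ hδ1 hg hint)
      ((ae_restrict_iff' hS).2 (Filter.Eventually.of_forall fun x hx =>
        Real.rpow_nonneg (hg x hx).le _))]
    exact setLIntegral_congr_fun hS fun x hx => ENNReal.ofReal_rpow_of_pos (hg x hx)
  rw [h2, ← ofReal_integral_eq_lintegral_ofReal hint ((ae_restrict_iff' hS).2
    (Filter.Eventually.of_forall fun x hx => (hg x hx).le)),
    ENNReal.ofReal_rpow_of_nonneg hnn (sub_nonneg.2 hδ1)] at h1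
  have h3 := h1.trans (mul_le_mul_right (ENNReal.rpow_le_rpow hvol hδ) _)
  rw [ENNReal.ofReal_rpow_of_nonneg hv.le hδ, ← ENNReal.ofReal_mul (by positivity),
    ENNReal.ofReal_le_ofReal_iff (by positivity)] at h3
  exact h3

section ShiftedPrimitive

variable {α γ δ c : ℝ} {g : ℝ → ℝ} {Ω : Set ℝ}

/-- Here `M` becomes the variable on which the up transformation acts. For γ < 2 the exponent of
|(γ-2)M| is negative, so it is enough to keep `M` away from 0. A primitive is bounded above because
the support ends at or before 0, and a shift brings it below -1. -/
theorem exists_shiftedPrimitive_of_lt (hα : 0 < α) (hγ : γ < 2) (hδ : 0 < δ) (hδ1 : δ < 1)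
    (hc : 0 < c) (hΩ : IsOpen Ω) (ho : Ω.OrdConnected) (hne : Ω.Nonempty) (hg : ∀ x ∈ Ω, 0 < g x)
    (hint : IntegrableOn g Ω) (hneg : Ω ⊆ Iio 0) :
    ∃ M : ℝ → ℝ, StrictPrimitiveOn (fun t => c * g t ^ (1 - δ)) M Ω ∧ (∀ t ∈ Ω, M t ≠ 0) ∧
      IntegrableOn (fun t => |(γ - 2) * M t| ^ (-(1 / (α * (2 - γ)))) * g t) Ω := by
  obtain ⟨t₀, ht₀⟩ := hne
  have hloc : ∀ a b, Icc a b ⊆ Ω → IntegrableOn (fun t => g t ^ (1 - δ)) (Icc a b) := fun a b hab =>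
    integrableOn_rpow_of_volume_ne_top measurableSet_Icc measure_Icc_lt_top.ne hδ.le hδ1.le
      (fun x hx => hg x (hab hx)) (hint.mono_set hab)
  have hii : ∀ a ∈ Ω, ∀ b ∈ Ω, IntervalIntegrable (fun t => c * g t ^ (1 - δ)) volume a b :=
    fun a ha b hb => by
      rw [intervalIntegrable_iff']
      exact (hloc _ _ (ho.uIcc_subset ha hb)).const_mul c
  have hpos : ∀ t ∈ Ω, 0 < c * g t ^ (1 - δ) := fun t ht =>
    mul_pos hc (Real.rpow_pos_of_pos (hg t ht) _)
  set G := ∫ t in Ω, g t with hG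
  have hGnn : 0 ≤ G := setIntegral_nonneg hΩ.measurableSet fun t ht => (hg t ht).le
  have ht₀' : t₀ < 0 := hneg ht₀
  -- The Hölder bound on [t₀, t], an interval of length at most -t₀ since t < 0.
  set B := c * (G ^ (1 - δ) * (-t₀) ^ δ) with hB
  have hBnn : 0 ≤ B := by
    have : 0 ≤ -t₀ := by linarith
    positivity
  have hbound : ∀ t ∈ Ω, ∫ x in t₀..t, c * g x ^ (1 - δ) ≤ B := by
    intro t ht
    rcases le_total t₀ t with h | h
    · have hsub : Icc t₀ t ⊆ Ω := ho.out ht₀ ht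
      have ht' : t < 0 := hneg ht
      rw [intervalIntegral.integral_const_mul, intervalIntegral.integral_of_le h,
        ← integral_Icc_eq_integral_Ioc]
      refine mul_le_mul_of_nonneg_left ((setIntegral_rpow_le measurableSet_Icc (v := -t₀)
        (by linarith) ?_ hδ.le hδ1.le (fun x hx => hg x (hsub hx)) (hint.mono_set hsub)).trans ?_)
        hc.le
      · rw [Real.volume_Icc]
        exact ENNReal.ofReal_le_ofReal (by linarith)
      · refine mul_le_mul_of_nonneg_right (Real.rpow_le_rpow (setIntegral_nonneg measurableSet_Icc
          fun x hx => (hg x (hsub hx)).le) ?_ (by linarith)) (Real.rpow_nonneg (by linarith) _)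
        exact setIntegral_mono_set hint ((ae_restrict_iff' hΩ.measurableSet).2
          (Filter.Eventually.of_forall fun x hx => (hg x hx).le))
          (Filter.Eventually.of_forall hsub)
    · rw [intervalIntegral.integral_symm]
      have : 0 ≤ ∫ x in t..t₀, c * g x ^ (1 - δ) := intervalIntegral.integral_nonneg h
        fun x hx => (hpos x (ho.out ht ht₀ hx)).le
      linarith
  have hM : StrictPrimitiveOn (fun t => c * g t ^ (1 - δ))
      (fun t => (∫ x in t₀..t, c * g x ^ (1 - δ)) + (-B - 1)) Ω :=
    ⟨hΩ, ho, (isPrimitiveOn_intervalIntegral ht₀ hii).add_const _, Or.inl hpos⟩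
  have hle : ∀ t ∈ Ω, (∫ x in t₀..t, c * g x ^ (1 - δ)) + (-B - 1) ≤ -1 := fun t ht => by
    linarith [hbound t ht]
  have hne : ∀ t ∈ Ω, (∫ x in t₀..t, c * g x ^ (1 - δ)) + (-B - 1) ≠ 0 := fun t ht =>
    ((hle t ht).trans_lt (by norm_num)).ne
  refine ⟨_, hM, hne, ?_⟩
  have habs : ∀ t ∈ Ω, 2 - γ ≤ |(γ - 2) * ((∫ x in t₀..t, c * g x ^ (1 - δ)) + (-B - 1))| := by
    intro t ht
    refine le_trans ?_ (le_abs_self _)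
    nlinarith [hle t ht]
  have hθ : 0 < α * (2 - γ) := mul_pos hα (by linarith)
  refine (hint.const_mul ((2 - γ) ^ (-(1 / (α * (2 - γ)))))).mono' ?_ ?_
  · refine (ContinuousOn.aestronglyMeasurable ?_ hΩ.measurableSet).mul hint.aestronglyMeasurable
    exact (continuousOn_const.mul hM.continuousOn).abs.rpow_const fun t ht => Or.inl
      (abs_ne_zero.2 (mul_ne_zero (sub_ne_zero.2 hγ.ne) (hne t ht)))
  · refine (ae_restrict_iff' hΩ.measurableSet).2 (Filter.Eventually.of_forall fun t ht => ?_)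
    rw [Real.norm_of_nonneg (mul_nonneg (Real.rpow_nonneg (abs_nonneg _) _) (hg t ht).le)]
    refine mul_le_mul_of_nonneg_right ?_ (hg t ht).le
    exact Real.rpow_le_rpow_of_nonpos (by linarith) (habs t ht) (neg_nonpos.2 (by positivity))

/-- For γ > 2 the exponent is positive, so `M` must be kept small: it is started from 0 at the left
end of the support. Hölder on a subset of (0, t) gives M(t) ≤ C t^δ, which reduces the claim to the
assumed moment of `g`. -/
theorem exists_shiftedPrimitive_of_gt (hα : 0 < α) (hγ : 2 < γ) (hδ : 0 < δ) (hδ1 : δ < 1)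
    (hc : 0 < c) (hΩ : IsOpen Ω) (ho : Ω.OrdConnected) (hg : ∀ x ∈ Ω, 0 < g x)
    (hint : IntegrableOn g Ω) (hpos : Ω ⊆ Ioi 0)
    (hpow : IntegrableOn (fun t => t ^ (δ / (α * (γ - 2))) * g t) Ω) :
    ∃ M : ℝ → ℝ, StrictPrimitiveOn (fun t => c * g t ^ (1 - δ)) M Ω ∧ (∀ t ∈ Ω, M t ≠ 0) ∧
      IntegrableOn (fun t => |(γ - 2) * M t| ^ (-(1 / (α * (2 - γ)))) * g t) Ω := by
  have hvol : ∀ t ∈ Ω, volume (Ω ∩ Iio t) ≤ ENNReal.ofReal t := fun t ht => by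
    refine (measure_mono (t := Ioo 0 t) fun x hx => ⟨hpos hx.1, hx.2⟩).trans ?_
    rw [Real.volume_Ioo, sub_zero]
  have hS : ∀ t, MeasurableSet (Ω ∩ Iio t) := fun t => hΩ.measurableSet.inter measurableSet_Iio
  have hgi : ∀ t ∈ Ω, IntegrableOn (fun t => g t ^ (1 - δ)) (Ω ∩ Iio t) := fun t ht =>
    integrableOn_rpow_of_volume_ne_top (hS t) (ne_top_of_le_ne_top ENNReal.ofReal_ne_top (hvol t ht))
      hδ.le hδ1.le (fun x hx => hg x hx.1) (hint.mono_set inter_subset_left)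
  have hwpos : ∀ t ∈ Ω, 0 < c * g t ^ (1 - δ) := fun t ht =>
    mul_pos hc (Real.rpow_pos_of_pos (hg t ht) _)
  have hM : StrictPrimitiveOn (fun t => c * g t ^ (1 - δ))
      (fun t => c * ∫ x in Ω ∩ Iio t, g x ^ (1 - δ)) Ω :=
    ⟨hΩ, ho, (isPrimitiveOn_setIntegral_Iio ho hgi).const_mul c, Or.inl hwpos⟩
  have hMpos : ∀ t ∈ Ω, 0 < c * ∫ x in Ω ∩ Iio t, g x ^ (1 - δ) := fun t ht => by
    obtain ⟨a, b, hat, htb, hab⟩ := StrictPrimitiveOn.exists_Icc_mem_nhds hΩ ht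
    exact mul_pos hc (setIntegral_pos (hΩ.inter isOpen_Iio) ⟨a, hab ⟨le_rfl, by linarith⟩, hat⟩
      (fun x hx => Real.rpow_pos_of_pos (hg x hx.1) _) (hgi t ht))
  set G := ∫ t in Ω, g t with hG
  have hGnn : 0 ≤ G := setIntegral_nonneg hΩ.measurableSet fun t ht => (hg t ht).le
  have hMle : ∀ t ∈ Ω, c * ∫ x in Ω ∩ Iio t, g x ^ (1 - δ) ≤ c * (G ^ (1 - δ) * t ^ δ) :=
    fun t ht => by
      have ht0 : 0 < t := hpos ht
      refine mul_le_mul_of_nonneg_left ((setIntegral_rpow_le (hS t) ht0 (hvol t ht) hδ.le hδ1.le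
        (fun x hx => hg x hx.1) (hint.mono_set inter_subset_left)).trans ?_) hc.le
      refine mul_le_mul_of_nonneg_right (Real.rpow_le_rpow (setIntegral_nonneg (hS t)
        fun x hx => (hg x hx.1).le) ?_ (by linarith)) (Real.rpow_nonneg ht0.le _)
      exact setIntegral_mono_set hint ((ae_restrict_iff' hΩ.measurableSet).2
        (Filter.Eventually.of_forall fun x hx => (hg x hx).le))
        (Filter.Eventually.of_forall inter_subset_left)
  have hγ2 : 0 < γ - 2 := by linarith
  have hexp : -(1 / (α * (2 - γ))) = 1 / (α * (γ - 2)) := by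
    rw [← div_neg, ← mul_neg, neg_sub]
  refine ⟨_, hM, fun t ht => (hMpos t ht).ne', ?_⟩
  rw [hexp]
  refine (hpow.const_mul (((γ - 2) * (c * G ^ (1 - δ))) ^ (1 / (α * (γ - 2))))).mono' ?_ ?_
  · refine (ContinuousOn.aestronglyMeasurable ?_ hΩ.measurableSet).mul hint.aestronglyMeasurable
    exact (continuousOn_const.mul hM.continuousOn).abs.rpow_const fun t ht => Or.inl
      (abs_ne_zero.2 (mul_ne_zero hγ2.ne' (hMpos t ht).ne'))
  · refine (ae_restrict_iff' hΩ.measurableSet).2 (Filter.Eventually.of_forall fun t ht => ?_)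
    have ht0 : 0 < t := hpos ht
    rw [Real.norm_of_nonneg (mul_nonneg (Real.rpow_nonneg (abs_nonneg _) _) (hg t ht).le),
      ← mul_assoc (_ ^ _) (_ ^ _) (g t)]
    refine mul_le_mul_of_nonneg_right ?_ (hg t ht).le
    rw [abs_of_pos (mul_pos hγ2 (hMpos t ht)), div_eq_mul_one_div δ, Real.rpow_mul ht0.le,
      ← Real.mul_rpow (by positivity) (by positivity)]
    refine Real.rpow_le_rpow (mul_pos hγ2 (hMpos t ht)).le ?_ (by positivity)
    rw [mul_assoc, mul_assoc]
    exact mul_le_mul_of_nonneg_left (hMle t ht) hγ2.le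

end ShiftedPrimitive

theorem exists_isUp {γ : ℝ} {g : ℝ → ℝ} {Ω : Set ℝ} (hγ : γ ≠ 2) (hΩ : IsOpen Ω)
    (hc : Ω.OrdConnected) (hne : Ω.Nonempty) (hg : ∀ x ∈ Ω, 0 < g x) (hint : IntegrableOn g Ω)
    (h0 : (0 : ℝ) ∉ Ω) :
    ∃ (u g' : ℝ → ℝ), StrictPrimitiveOn (fun x => -(|(γ - 2) * x| ^ (1 / (γ - 2)) * g x)) u Ω ∧
      (∀ x ∈ Ω, g' (u x) = |(γ - 2) * x| ^ (1 / (2 - γ))) ∧ IsUp γ Ω g (u '' Ω) g' := by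
  obtain ⟨x₀, hx₀⟩ := hne
  have hA : ∀ x ∈ Ω, 0 < |(γ - 2) * x| := fun x hx =>
    abs_pos.2 (mul_ne_zero (sub_ne_zero.2 hγ) fun h => h0 (h ▸ hx))
  have hii : ∀ a ∈ Ω, ∀ b ∈ Ω, IntervalIntegrable
      (fun x => -(|(γ - 2) * x| ^ (1 / (γ - 2)) * g x)) volume a b := fun a ha b hb => by
    have hsub := hc.uIcc_subset ha hb
    rw [intervalIntegrable_iff']
    refine ((hint.mono_set hsub).continuousOn_mul ?_ isCompact_uIcc).neg
    exact (continuousOn_const.mul continuousOn_id).abs.rpow_const fun x hx =>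
      Or.inl (hA x (hsub hx)).ne'
  have hu : StrictPrimitiveOn (fun x => -(|(γ - 2) * x| ^ (1 / (γ - 2)) * g x))
      (fun x => ∫ t in x₀..x, -(|(γ - 2) * t| ^ (1 / (γ - 2)) * g t)) Ω :=
    ⟨hΩ, hc, isPrimitiveOn_intervalIntegral hx₀ hii, Or.inr fun x hx =>
      neg_neg_of_pos (mul_pos (Real.rpow_pos_of_pos (hA x hx) _) (hg x hx))⟩
  have hg' : ∀ x ∈ Ω, (fun t => |(γ - 2) * Function.invFunOn
      (fun x => ∫ t in x₀..x, -(|(γ - 2) * t| ^ (1 / (γ - 2)) * g t)) Ω t| ^ (1 / (2 - γ)))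
      ((fun x => ∫ t in x₀..x, -(|(γ - 2) * t| ^ (1 / (γ - 2)) * g t)) x) =
        |(γ - 2) * x| ^ (1 / (2 - γ)) := fun x hx => by
    simp only [hu.injOn.leftInvOn_invFunOn hx]
  exact ⟨_, fun t => |(γ - 2) * Function.invFunOn
      (fun x => ∫ t in x₀..x, -(|(γ - 2) * t| ^ (1 / (γ - 2)) * g t)) Ω t| ^ (1 / (2 - γ)),
    hu, hg', h0, _, hu.prim, rfl, hg'⟩

/-- The inverse escort, the divergence transformation and the next escort together carry `g₂` to
`g₅` by a change of variable `M` with M' = K^(-α) r^(-δ) g₂^(1-δ). Any primitive of this weight may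
serve, so the conditions for the up step and the final inverse escort become conditions on `M` and
`g₂` alone. -/
theorem exists_isConjUp {α γ δ K r : ℝ} {h F F' g₂ y z M : ℝ → ℝ} {Ω Ω₂ : Set ℝ} (hα : 0 < α)
    (hγ : γ ≠ 2) (hΩ : IsOpen Ω) (hc : Ω.OrdConnected) (hne : Ω.Nonempty)
    (hh : ∀ x ∈ Ω, 0 < h x) (hhint : IntegrableOn h Ω) (hh1 : ∫ x in Ω, h x = 1)
    (hg₂ : ∀ x ∈ Ω₂, 0 < g₂ x) (hg₂int : IntegrableOn g₂ Ω₂) (hr : 0 < r)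
    (hz : StrictPrimitiveOn (fun x => r * ((r * g₂ (z x)) ^ (-((α - 1) / α)) * h x)) z Ω)
    (hzimg : z '' Ω = Ω₂) (hF : ∀ x ∈ Ω, F x = (r * g₂ (z x)) ^ (1 / α) * h x) (hK : 0 < K)
    (hy : StrictPrimitiveOn (fun x => K⁻¹ * (h x ^ δ * F x ^ (1 - δ)) * (h (y x))⁻¹) y Ω)
    (hyimg : y '' Ω = Ω) (hF' : ∀ x ∈ Ω, F' (y x) = K * (F x / h x) ^ δ * h (y x))
    (hM : StrictPrimitiveOn (fun t => K ^ (-α) * r ^ (-δ) * g₂ t ^ (1 - δ)) M Ω₂)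
    (hM0 : ∀ t ∈ Ω₂, M t ≠ 0)
    (hMint : IntegrableOn (fun t => |(γ - 2) * M t| ^ (-(1 / (α * (2 - γ)))) * g₂ t) Ω₂) :
    ∃ k, IsConjUp γ α h Ω F' k := by
  have hzmem : ∀ x ∈ Ω, z x ∈ Ω₂ := fun x hx => hzimg ▸ mem_image_of_mem z hx
  have hymem : ∀ x ∈ Ω, y x ∈ Ω := fun x hx => hyimg.subset (mem_image_of_mem y hx)
  set η := Function.invFunOn y Ω
  have hη : ∀ x ∈ Ω, η (y x) = x := fun x hx => hy.injOn.leftInvOn_invFunOn hx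
  have hηy : StrictPrimitiveOn _ η Ω := hyimg ▸ hy.inverse hη
  have hηimg : η '' Ω = Ω := by
    conv_lhs => rw [← hyimg]
    exact hy.injOn.leftInvOn_invFunOn.image_image
  have hMz := hz.comp (hzimg.symm ▸ hM)
  have hy₅ := hηy.comp (hηimg.symm ▸ hMz)
  have hF'pos : ∀ v ∈ Ω, 0 < F' v := by
    rw [← hyimg]
    rintro _ ⟨x, hx, rfl⟩
    have h1 := hg₂ _ (hzmem x hx)
    have h2 := hh x hx
    have h3 := hh _ (hymem x hx)
    rw [hF' x hx, hF x hx]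
    positivity
  have hdivF : ∀ x ∈ Ω, F' (y x) / h (y x) = K * (r * g₂ (z x)) ^ (δ / α) := fun x hx => by
    have h1 := hg₂ _ (hzmem x hx)
    rw [hF' x hx, hF x hx, mul_div_assoc, div_self (hh _ (hymem x hx)).ne', mul_one,
      mul_div_assoc, div_self (hh x hx).ne', mul_one, ← Real.rpow_mul (by positivity)]
    congr 2
    ring
  have hprim : IsPrimitiveOn (fun x => F' x ^ (1 - α) * h x ^ α) (fun v => M (z (η v))) Ω := by
    refine hy₅.prim.congr hc ?_ fun _ _ => rfl
    have key : ∀ x ∈ Ω, (K⁻¹ * (h (η (y x)) ^ δ * F (η (y x)) ^ (1 - δ)) * (h (y (η (y x))))⁻¹)⁻¹ *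
        (r * ((r * g₂ (z (η (y x)))) ^ (-((α - 1) / α)) * h (η (y x))) *
          (K ^ (-α) * r ^ (-δ) * g₂ (z (η (y x))) ^ (1 - δ))) =
          F' (y x) ^ (1 - α) * h (y x) ^ α := by
      intro x hx
      rw [hη x hx, hF' x hx, hF x hx]
      obtain ⟨a, ha⟩ := exists_eq_exp (hg₂ _ (hzmem x hx))
      obtain ⟨b, hb⟩ := exists_eq_exp (hh x hx)
      obtain ⟨c, hc⟩ := exists_eq_exp (hh _ (hymem x hx))
      obtain ⟨d, hd⟩ := exists_eq_exp hK
      obtain ⟨e, he⟩ := exists_eq_exp hr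
      rw [ha, hb, hc, hd, he]
      simp only [← Real.exp_sub, ← Real.exp_mul, ← Real.exp_add, ← Real.exp_neg]
      congr 1
      field_simp
      ring
    intro v hv
    obtain ⟨x, hx, rfl⟩ : v ∈ y '' Ω := hyimg.symm ▸ hv
    exact key x hx
  have himg : (fun v => M (z (η v))) '' Ω = M '' Ω₂ := by
    rw [← image_image (fun x => M (z x)) η, hηimg, ← image_image M z, hzimg]
  have hE := exists_isRelEscort_of_isPrimitiveOn hΩ hc hF'pos hh hprim
  have hinj := (strictPrimitiveOn_relEscort hΩ hc hF'pos hh hprim).injOn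
  rw [himg] at hE
  set g₅ : ℝ → ℝ := fun t => (F' (Function.invFunOn (fun v => M (z (η v))) Ω t) /
    h (Function.invFunOn (fun v => M (z (η v))) Ω t)) ^ α with hg₅def
  have hg₅ : ∀ t ∈ Ω₂, g₅ (M t) = K ^ α * (r * g₂ t) ^ δ := by
    rw [← hzimg]
    rintro _ ⟨x, hx, rfl⟩
    have h1 := hg₂ _ (hzmem x hx)
    have h2 : M (z x) = (fun v => M (z (η v))) (y x) := by simp only [hη x hx]
    rw [hg₅def]
    simp only
    rw [h2, hinj.leftInvOn_invFunOn (hymem x hx), hdivF x hx, Real.mul_rpow hK.le (by positivity),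
      ← Real.rpow_mul (by positivity), div_mul_cancel₀ _ hα.ne']
  have hg₅pos : ∀ t ∈ M '' Ω₂, 0 < g₅ t := by
    rintro _ ⟨t, ht, rfl⟩
    have := hg₂ t ht
    rw [hg₅ t ht]
    positivity
  have hmass : ∀ t ∈ Ω₂, |K ^ (-α) * r ^ (-δ) * g₂ t ^ (1 - δ)| * g₅ (M t) = g₂ t := fun t ht => by
    rw [hg₅ t ht]
    obtain ⟨a, ha⟩ := exists_eq_exp (hg₂ _ ht)
    obtain ⟨d, hd⟩ := exists_eq_exp hK
    obtain ⟨e, he⟩ := exists_eq_exp hr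
    rw [ha, hd, he, abs_of_pos (by positivity)]
    simp only [← Real.exp_mul, ← Real.exp_add]
    congr 1
    ring
  have hg₅int : IntegrableOn g₅ (M '' Ω₂) := by
    rw [hM.integrableOn_image_univ]
    exact hg₂int.congr_fun (fun t ht => (hmass t ht).symm) hM.measurableSet
  have hne₅ : (M '' Ω₂).Nonempty := by rw [← himg]; exact hne.image _
  have h0 : (0 : ℝ) ∉ M '' Ω₂ := by
    rintro ⟨t, ht, h⟩
    exact hM0 t ht h
  obtain ⟨u, g₆, hu, hg₆, hU⟩ := exists_isUp hγ hM.image_isOpen hM.image_ordConnected hne₅ hg₅pos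
    hg₅int h0
  have hA : ∀ x ∈ M '' Ω₂, 0 < |(γ - 2) * x| := fun x hx =>
    abs_pos.2 (mul_ne_zero (sub_ne_zero.2 hγ) fun h => h0 (h ▸ hx))
  -- The finiteness required by the final inverse escort, pulled back through `u` and `M`: the two
  -- powers of |(γ-2)M| combine to -1/(α(2-γ)), and the remaining factor is the mass element of
  -- `g₂`.
  have hg₆int : IntegrableOn (fun x => g₆ x ^ ((α - 1) / α)) (u '' (M '' Ω₂)) := by
    rw [hu.integrableOn_image_univ, hM.integrableOn_image_univ]
    refine hMint.congr_fun (fun t ht => ?_) hM.measurableSet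
    have hMt := mem_image_of_mem M ht
    have hpow : |(γ - 2) * M t| ^ (1 / (γ - 2)) * (|(γ - 2) * M t| ^ (1 / (2 - γ))) ^ ((α - 1) / α) =
        |(γ - 2) * M t| ^ (-(1 / (α * (2 - γ)))) := by
      rw [← Real.rpow_mul (hA _ hMt).le, ← Real.rpow_add (hA _ hMt)]
      congr 1
      have h1 : (2 - γ) ≠ 0 := sub_ne_zero.2 hγ.symm
      rw [show γ - 2 = -(2 - γ) by ring, div_neg]
      field_simp
      ring
    simp only
    rw [hg₆ _ hMt, abs_neg, abs_of_pos (mul_pos (Real.rpow_pos_of_pos (hA _ hMt) _)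
      (hg₅pos _ hMt)), ← hpow]
    conv_lhs => rw [← hmass t ht]
    ring
  have hg₆pos : ∀ x ∈ u '' (M '' Ω₂), 0 < g₆ x := by
    rintro _ ⟨x, hx, rfl⟩
    rw [hg₆ x hx]
    exact Real.rpow_pos_of_pos (hA x hx) _
  obtain ⟨k, hk⟩ := exists_isRelEscortInv hα hΩ hc hh hhint hh1 hu.image_isOpen
    hu.image_ordConnected (hne₅.image u) hg₆pos hg₆int
  exact ⟨k, _, _, _, _, hE, hU, hk⟩

theorem exists_isConjugatedTransform {α γ δ : ℝ} {h f : ℝ → ℝ} {Ω : Set ℝ} (hα : 0 < α)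
    (hγ : γ ≠ 2) (hδ : 0 < δ) (hδ1 : δ < 1) (hfh : DensityPair Ω f h)
    (hfd : ∀ x ∈ Ω, DifferentiableAt ℝ f x) (hhd : ∀ x ∈ Ω, DifferentiableAt ℝ h x)
    (hdec : ∀ x ∈ Ω, deriv (fun t => f t / h t) x < 0)
    (hfin : relFisherIntegral (1 / α) (α * (2 - γ)) Ω f h < ∞) :
    ∃ k, IsConjugatedTransform γ α δ h Ω f k := by
  have hΩ := hfh.isOpen
  have hc := hfh.ordConnected
  have hne := hfh.nonempty
  have hf := hfh.f_pos
  have hh := hfh.h_pos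
  obtain ⟨y₁, s, g₁, g₂, hy₁, hg₁, hs, hs_eq, hg₂, H₁, H₂⟩ :=
    exists_isRelEscort_isDown hα hγ hfh hfd hhd hdec
  obtain ⟨hΩ₂, hc₂, hne₂, hg₂pos, hmom⟩ :=
    H₁.down_powerMoment_eq H₂ hα hΩ hc hne hf hh hfd hhd hdec
  have hg₁pos : ∀ t ∈ y₁ '' Ω, 0 < g₁ t := by
    rintro _ ⟨x, hx, rfl⟩
    rw [hg₁ x hx]
    exact Real.rpow_pos_of_pos (div_pos (hf x hx) (hh x hx)) _
  have hmass_s : ∀ t ∈ y₁ '' Ω, abs (g₁ t ^ (1 - γ) * |deriv g₁ t|) * g₂ (s t) = g₁ t := fun t ht => by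
    have hd : 0 < |deriv g₁ t| := abs_pos.2 (H₂.1 t ht).2.ne
    have hg := hg₁pos t ht
    rw [hg₂ t ht, abs_of_pos (by positivity), mul_mul_mul_comm, mul_inv_cancel₀ hd.ne', mul_one,
      ← Real.rpow_add hg, sub_add_cancel, Real.rpow_one]
  have hmass_y : ∀ x ∈ Ω, |f x ^ (1 - α) * h x ^ α| * g₁ (y₁ x) = f x := fun x hx => by
    rw [hg₁ x hx]
    obtain ⟨a, ha⟩ := exists_eq_exp (hf x hx)
    obtain ⟨b, hb⟩ := exists_eq_exp (hh x hx)
    rw [ha, hb, abs_of_pos (by positivity)]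
    simp only [← Real.exp_sub, ← Real.exp_mul, ← Real.exp_add]
    congr 1
    ring
  have hg₂int : IntegrableOn g₂ (s '' (y₁ '' Ω)) := by
    rw [hs.integrableOn_image_univ, integrableOn_congr_fun hmass_s hs.measurableSet,
      hy₁.integrableOn_image_univ, integrableOn_congr_fun hmass_y hΩ.measurableSet]
    exact hfh.f_integrableOn
  -- The exponent is 1 - 1/α, so up to a factor this moment is the Fisher integral of order 1/α,
  -- which is finite by assumption.
  have hg₂ξ : IntegrableOn (fun x => g₂ x ^ ((α - 1) / α)) (s '' (y₁ '' Ω)) := by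
    rw [IntegrableOn, ← lintegral_ofReal_ne_top_iff_integrable
      (hg₂int.aestronglyMeasurable.aemeasurable.pow_const _).aestronglyMeasurable
      ((ae_restrict_iff' hΩ₂.measurableSet).2 (Filter.Eventually.of_forall fun x hx =>
        Real.rpow_nonneg (hg₂pos x hx).le _))]
    intro htop
    rw [hmom, show 1 - 1 / α = (α - 1) / α by field_simp, powerMoment, htop,
      ENNReal.mul_top (ENNReal.ofReal_pos.2 (Real.rpow_pos_of_pos hα _)).ne'] at hfin
    exact lt_irrefl _ hfin
  obtain ⟨F, H₃⟩ := exists_isRelEscortInv hα hΩ hc hh hfh.h_integrableOn hfh.h_integral hΩ₂ hc₂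
    hne₂ hg₂pos hg₂ξ
  obtain ⟨r, hr, z, hz, hzimg, hF⟩ := H₃.exists_strictPrimitiveOn hΩ hc hΩ₂ hne₂ hg₂pos hh
  have hgz : ∀ x ∈ Ω, 0 < g₂ (z x) := fun x hx => hg₂pos _ (hzimg ▸ mem_image_of_mem z hx)
  have hFpos : ∀ x ∈ Ω, 0 < F x := fun x hx => by
    have h1 := hgz x hx
    have h2 := hh x hx
    rw [hF x hx]
    positivity
  have hFint : IntegrableOn F Ω := by
    have h1 := hz.integrableOn_image_univ g₂
    rw [hzimg] at h1
    refine (h1.1 hg₂int).congr_fun (fun x hx => ?_) hΩ.measurableSet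
    simp only
    rw [hF x hx]
    obtain ⟨a, ha⟩ := exists_eq_exp (hgz x hx)
    obtain ⟨b, hb⟩ := exists_eq_exp (hh x hx)
    obtain ⟨c, hc⟩ := exists_eq_exp hr
    rw [ha, hb, hc, abs_of_pos (by positivity)]
    simp only [← Real.exp_mul, ← Real.exp_add]
    congr 1
    field_simp
    ring
  obtain ⟨F', H₄⟩ := exists_isDivergenceTransform hδ hδ1 hΩ hc hne hh hfh.h_integrableOn
    hfh.h_integral hFpos hFint
  obtain ⟨K, hK, y, hy, hyimg, hF'⟩ :=
    H₄.exists_strictPrimitiveOn hΩ hc hne hh hfh.h_integrableOn hFpos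
  have hc0 : 0 < K ^ (-α) * r ^ (-δ) := by positivity
  have hM : ∃ M : ℝ → ℝ, StrictPrimitiveOn (fun t => K ^ (-α) * r ^ (-δ) * g₂ t ^ (1 - δ)) M
      (s '' (y₁ '' Ω)) ∧ (∀ t ∈ s '' (y₁ '' Ω), M t ≠ 0) ∧
      IntegrableOn (fun t => |(γ - 2) * M t| ^ (-(1 / (α * (2 - γ)))) * g₂ t)
        (s '' (y₁ '' Ω)) := by
    rcases hγ.lt_or_gt with hlt | hgt
    · refine exists_shiftedPrimitive_of_lt hα hlt hδ hδ1 hc0 hΩ₂ hc₂ hne₂ hg₂pos hg₂int ?_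
      rintro _ ⟨t, ht, rfl⟩
      rw [hs_eq t ht]
      exact div_neg_of_pos_of_neg (Real.rpow_pos_of_pos (hg₁pos t ht) _) (by linarith)
    · have hγ2 : 0 < γ - 2 := by linarith
      refine exists_shiftedPrimitive_of_gt hα hgt hδ hδ1 hc0 hΩ₂ hc₂ hg₂pos hg₂int ?_ ?_
      · rintro _ ⟨t, ht, rfl⟩
        rw [hs_eq t ht]
        exact div_pos (Real.rpow_pos_of_pos (hg₁pos t ht) _) hγ2
      -- On the support, s^(δ/(α(γ-2))) is a multiple of (f/h)^(-δ), so the required moment is a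
      -- multiple of ∫ h^δ f^(1-δ), again finite by AM-GM.
      · rw [hs.integrableOn_image_univ, hy₁.integrableOn_image_univ]
        refine IntegrableOn.congr_fun ((integrableOn_rpow_mul_rpow hΩ.measurableSet hδ.le hδ1.le hh
          hfh.h_integrableOn hf hfh.f_integrableOn).const_mul
          ((γ - 2) ^ (-(δ / (α * (γ - 2)))))) (fun x hx => ?_) hΩ.measurableSet
        have hyx := mem_image_of_mem y₁ hx
        rw [mul_left_comm |_| (_ ^ _) (g₂ _), hmass_s _ hyx, mul_left_comm |_| (_ ^ _) (g₁ _),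
          hmass_y x hx, hs_eq _ hyx, hg₁ x hx]
        obtain ⟨a, ha⟩ := exists_eq_exp (hf x hx)
        obtain ⟨b, hb⟩ := exists_eq_exp (hh x hx)
        obtain ⟨c, hc⟩ := exists_eq_exp hγ2
        rw [show 2 - γ = -(γ - 2) by ring, ha, hb, hc]
        simp only [← Real.exp_sub, ← Real.exp_mul, ← Real.exp_add]
        congr 1
        field_simp
        ring
  obtain ⟨M, hM, hM0, hMint⟩ := hM
  obtain ⟨k, hk⟩ := exists_isConjUp hα hγ hΩ hc hne hh hfh.h_integrableOn hfh.h_integral hg₂pos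
    hg₂int hr hz hzimg hF hK hy hyimg hF' hM hM0 hMint
  exact ⟨k, F, F', ⟨_, _, _, _, H₁, H₂, H₃⟩, H₄, hk⟩

/-! ### From Fisher integrals to complexities, and conclusion -/

section Complexity

variable {α γ lam β c : ℝ} {Ω : Set ℝ} {k h : ℝ → ℝ} {J : ℝ → ℝ≥0∞}

/-- The exponent 1/(pθ) turns c^p into c^(1/θ), which no longer depends on `p` and so cancels in the
quotient. -/
theorem relFisher_eq_mul_rpow {p θ : ℝ} (hp : p ≠ 0) (hc : 0 < c)
    (H : relFisherIntegral p θ Ω k h = ENNReal.ofReal (c ^ p) * J p) :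
    relFisher p θ Ω k h = ENNReal.ofReal (c ^ (1 / θ)) * (J p ^ (1 / p)) ^ (1 / θ) := by
  have hcp : 0 < c ^ p := Real.rpow_pos_of_pos hc p
  have h0 : ENNReal.ofReal (c ^ p) ≠ 0 := (ENNReal.ofReal_pos.2 hcp).ne'
  rw [relFisher, H, ENNReal.mul_rpow_eq_ite, if_neg (by simp [h0]),
    ENNReal.ofReal_rpow_of_pos hcp, ← Real.rpow_mul hc.le, ← ENNReal.rpow_mul]
  congr 3 <;> field_simp

theorem fisherComplexityDefined_iff (hα : 0 < α) (hγ : γ ≠ 2) (hlam : lam ≠ 0) (hβ : β ≠ 0)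
    (hc : 0 < c)
    (H : ∀ p, relFisherIntegral p (α * (2 - γ)) Ω k h = ENNReal.ofReal (c ^ p) * J p) :
    FisherComplexityDefined lam β (α * (2 - γ)) Ω k h ↔
      QuotientDefined (J lam ^ (1 / lam)) (J β ^ (1 / β)) := by
  have hθ : 1 / (α * (2 - γ)) ≠ 0 := one_div_ne_zero (mul_ne_zero hα.ne' (sub_ne_zero.2 hγ.symm))
  have hcθ : 0 < c ^ (1 / (α * (2 - γ))) := Real.rpow_pos_of_pos hc _
  change QuotientDefined _ _ ↔ _
  rw [relFisher_eq_mul_rpow hlam hc (H lam), relFisher_eq_mul_rpow hβ hc (H β),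
    QuotientDefined.mul_left_iff (ENNReal.ofReal_pos.2 hcθ).ne' ENNReal.ofReal_ne_top,
    QuotientDefined.rpow_iff hθ]

/-- Since (2-γ)/θ = 1/α is positive, the power 2-γ removes the sign of θ, and one direction of
inequality serves both γ < 2 and γ > 2. -/
theorem fisherComplexity_rpow_eq (hα : 0 < α) (hγ : γ ≠ 2) (hlam : lam ≠ 0) (hβ : β ≠ 0)
    (hc : 0 < c)
    (H : ∀ p, relFisherIntegral p (α * (2 - γ)) Ω k h = ENNReal.ofReal (c ^ p) * J p)
    (hdef : QuotientDefined (J lam ^ (1 / lam)) (J β ^ (1 / β))) :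
    fisherComplexity lam β (α * (2 - γ)) Ω k h ^ (2 - γ) =
      (J lam ^ (1 / lam) / J β ^ (1 / β)) ^ (1 / α) := by
  have hγ' : 2 - γ ≠ 0 := sub_ne_zero.2 hγ.symm
  have hcθ : 0 < c ^ (1 / (α * (2 - γ))) := Real.rpow_pos_of_pos hc _
  rw [fisherComplexity, relFisher_eq_mul_rpow hlam hc (H lam), relFisher_eq_mul_rpow hβ hc (H β),
    ENNReal.mul_div_mul_left _ _ (ENNReal.ofReal_pos.2 hcθ).ne' ENNReal.ofReal_ne_top,
    ← hdef.div_rpow, ← ENNReal.rpow_mul]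
  congr 1
  field_simp

end Complexity

theorem theorem4p2 (Ω : Set ℝ) (f h : ℝ → ℝ) (hfh : DensityPair Ω f h)
    (hf : ∀ x ∈ Ω, DifferentiableAt ℝ f x) (hh : ∀ x ∈ Ω, DifferentiableAt ℝ h x)
    (hdec : ∀ x ∈ Ω, deriv (fun t => f t / h t) x < 0)
    (lam β α γ : ℝ) (hlam : lam ≠ 0) (hβ : β ≠ 0) (hβlam : β < lam) (hα : 0 < α) (hγ : γ ≠ 2)
    (hfin : relFisherIntegral (1 / α) (α * (2 - γ)) Ω f h < ∞) :
    (∀ δ : ℝ, 0 < δ → δ < 1 →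
      (∃ k : ℝ → ℝ, IsConjugatedTransform γ α δ h Ω f k) ∧
      ∀ k : ℝ → ℝ, IsConjugatedTransform γ α δ h Ω f k →
        FisherComplexityDefined lam β (α * (2 - γ)) Ω f h →
        FisherComplexityDefined lam β (α * (2 - γ)) Ω k h ∧
        fisherComplexity lam β (α * (2 - γ)) Ω k h ^ (2 - γ) ≤
          fisherComplexity lam β (α * (2 - γ)) Ω f h ^ (2 - γ)) ∧
    (∀ δ : ℝ, 1 < δ →
      ∀ k : ℝ → ℝ, IsConjugatedTransform γ α δ h Ω f k →
        FisherComplexityDefined lam β (α * (2 - γ)) Ω k h →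
        FisherComplexityDefined lam β (α * (2 - γ)) Ω f h ∧
        fisherComplexity lam β (α * (2 - γ)) Ω f h ^ (2 - γ) ≤
          fisherComplexity lam β (α * (2 - γ)) Ω k h ^ (2 - γ)) := by
  set I : ℝ → ℝ≥0∞ := fun p => relFisherIntegral p (α * (2 - γ)) Ω f h with hI
  have hIf : ∀ p, relFisherIntegral p (α * (2 - γ)) Ω f h = ENNReal.ofReal (1 ^ p) * I p :=
    fun p => by rw [Real.one_rpow, ENNReal.ofReal_one, one_mul]
  have hI0 : ∀ p, I p ≠ 0 := hfh.relFisherIntegral_ne_zero hf hh hdec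
  have hI1 : I 0 ≠ ∞ := by
    rw [hI]
    simp only [hfh.relFisherIntegral_zero hf hh hdec]
    exact ENNReal.one_ne_top
  have hconv : ∀ p₁ p₂ a b : ℝ, 0 ≤ a → 0 ≤ b → a + b = 1 →
      I (a * p₁ + b * p₂) ≤ I p₁ ^ a * I p₂ ^ b := fun p₁ p₂ a b ha hb hab =>
    hfh.relFisherIntegral_convex_comb hf hh hdec p₁ p₂ ha hb hab
  constructor
  · intro δ hδ hδ1
    refine ⟨exists_isConjugatedTransform hα hγ hδ hδ1 hfh hf hh hdec hfin, fun k hk hdef => ?_⟩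
    obtain ⟨c, hc, hIk⟩ := hk.relFisherIntegral_eq hfh hα hγ hf hh hdec
    rw [fisherComplexityDefined_iff hα hγ hlam hβ one_pos hIf] at hdef
    obtain ⟨hdef', hle⟩ := hdef.of_logConvex hI0 hI1 hconv hlam hβ hβlam hδ hδ1
    rw [fisherComplexityDefined_iff (J := fun p => I (δ * p)) hα hγ hlam hβ hc hIk,
      fisherComplexity_rpow_eq (J := fun p => I (δ * p)) hα hγ hlam hβ hc hIk hdef',
      fisherComplexity_rpow_eq hα hγ hlam hβ one_pos hIf hdef]
    exact ⟨hdef', ENNReal.rpow_le_rpow hle (by positivity)⟩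
  · intro δ hδ k hk hdef
    have hδ0 : 0 < δ := by linarith
    obtain ⟨c, hc, hIk⟩ := hk.relFisherIntegral_eq hfh hα hγ hf hh hdec
    rw [fisherComplexityDefined_iff (J := fun p => I (δ * p)) hα hγ hlam hβ hc hIk] at hdef
    -- The roles of `f` and its image are exchanged: p ↦ I(δp) is again log-convex and finite at 0,
    -- and dilating its order by δ⁻¹ < 1 recovers `I`.
    have hcomp := QuotientDefined.of_logConvex (I := fun p => I (δ * p)) (δ := δ⁻¹)
      (fun p => hI0 _) (by simpa using hI1) (fun p₁ p₂ a b ha hb hab => by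
        have := hconv (δ * p₁) (δ * p₂) a b ha hb hab
        rwa [show a * (δ * p₁) + b * (δ * p₂) = δ * (a * p₁ + b * p₂) by ring] at this)
      hlam hβ hβlam (inv_pos.2 hδ0) (inv_lt_one_of_one_lt₀ hδ) hdef
    simp only [mul_inv_cancel_left₀ hδ0.ne'] at hcomp
    obtain ⟨hdef', hle⟩ := hcomp
    rw [fisherComplexityDefined_iff hα hγ hlam hβ one_pos hIf,
      fisherComplexity_rpow_eq (J := fun p => I (δ * p)) hα hγ hlam hβ hc hIk hdef,
      fisherComplexity_rpow_eq hα hγ hlam hβ one_pos hIf hdef']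
    exact ⟨hdef', ENNReal.rpow_le_rpow hle (by positivity)⟩
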